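/- Let $d\in\mathbb N$, $\beta\in(0,d]$ and $\alpha\in(0,d)$. For a finite signed Radon measure $\mu\in M_b(\mathbb R^d)$ let $$e^{t\Delta}\mu(x)=\int_{\mathbb R^d}\frac{1}{(4\pi t)^{d/2}}e^{-|x-y|^2/4t}\,d\mu(y),\qquad I_\alpha\mu(x)=\frac1{\Gamma(\alpha/2)}\int_0^\infty t^{\alpha/2-1}e^{t\Delta}\mu(x)\,dt .$$ A measure $a\in M_b(\mathbb R^d)$ is a $\beta$-atom if there is a closed cube $Q$ with sides parallel to the axes and side length $l(Q)>0$ such that $\operatorname{supp}a\subset Q$, $a(Q)=0$, $|t^{(d-\beta)/2}e^{t\Delta}a(x)|\le l(Q)^{-\beta}$ for all $x\in\mathbb R^d$ and $t>0$, and $|a|(\mathbb R^d)\le1$. The space $DS_\beta(\mathbb R^d)$ consists of the $\mu\in M_b(\mathbb R^d)$ for which there are $\lambda_{i,n}\in\mathbb R$ and $\beta$-atoms $a_{i,n}$ with $\limsup_n\sum_{i=1}^n|\lambda_{i,n}|<\infty$ and $$\int\varphi\,d\mu=\lim_{n\to\infty}\sum_{i=1}^n\lambda_{i,n}\int\varphi\,da_{i,n}\qquad\text{for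 all }\varphi\in C_0(\mathbb R^d);$$ $\|\mu\|_{DS_\beta}$ is the infimum of $\limsup_n\sum_{i=1}^n|\lambda_{i,n}|$ over all such representations. For $1<p<\infty$ let $\|g\|_{L^{p,1}}=p\int_0^\infty|\{|g|>s\}|^{1/p}\,ds$. Fix a Schwartz function $\Xi$ on $\mathbb R^d$ whose Fourier transform is compactly supported and equals $1$ in a neighbourhood of the origin, put $\Xi_k(x)=2^{kd}\Xi(2^kx)$ and $P_kf=f*\Xi_k-f*\Xi_{k-1}$ for $k\in\mathbb Z$ and $f\in\mathcal S'(\mathbb R^d)$, and let $$\|f\|_{\dot B^{0,1}_{p,1}(\mathbb R^d)}=\sum_{k\in\mathbb Z}\|P_kf\|_{L^{p,1}(\mathbb R^d)} .$$ Then there is a constant $C>0$, depending only on $\alpha,\beta,d$ (and on the function $\Xi$ fixed in the definition of the Besov--Lorentz norm), such that for every $\mu\in DS_\beta(\mathbb R^d)$ the integral defining $I_\alpha\mu(x)$ converges absolutely for almost every $x$, the function $I_\alpha\mu$ defines a tempered distribution by (absolutely convergent) integration against Schwartz functions, and $$\|I_\alpha\mu\|_{\dot B^{0,1}_{d/(d-\alpha),1}(\mathbb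 R^d)}\le C\,\|\mu\|_{DS_\beta(\mathbb R^d)} .$$ -/

import Mathlib

open MeasureTheory Set Filter Topology
open scoped ENNReal SchwartzMap ZeroAtInfty FourierTransform

noncomputable section

namespace DSSpace

/-! ### Heat extension, cubes, atoms and the atomic spaces

Finite Radon measures on `ℝ^d` are the signed Borel measures `SignedMeasure (EuclideanSpace ℝ (Fin d))`
(finite by definition, automatically Radon), and `∫ᵛ x, f x ∂<•μ` is the integral of `f`
against the signed measure `μ`. -/

/-- The heat kernel `(4πt)^{-d/2} exp(-|x|²/(4t))`. -/
def heatKernel (d : ℕ) (t : ℝ) (x : EuclideanSpace ℝ (Fin d)) : ℝ :=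
  (4 * Real.pi * t) ^ (-((d : ℝ) / 2)) * Real.exp (-‖x‖ ^ 2 / (4 * t))

/-- The heat extension `e^{tΔ} μ (x)` of a finite signed measure. -/
def heat {d : ℕ} (μ : SignedMeasure (EuclideanSpace ℝ (Fin d))) (t : ℝ)
    (x : EuclideanSpace ℝ (Fin d)) : ℝ :=
  ∫ᵛ y, heatKernel d t (x - y) ∂<•μ

/-- The closed cube with lower corner `c`, side length `l` and sides parallel to the axes. -/
def cube {d : ℕ} (c : EuclideanSpace ℝ (Fin d)) (l : ℝ) : Set (EuclideanSpace ℝ (Fin d)) :=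
  {x | ∀ i, c i ≤ x i ∧ x i ≤ c i + l}

/-- `β`-atoms. -/
def IsAtom {d : ℕ} (β : ℝ) (a : SignedMeasure (EuclideanSpace ℝ (Fin d))) : Prop :=
  ∃ (c : EuclideanSpace ℝ (Fin d)) (l : ℝ), 0 < l ∧
    a.totalVariation.support ⊆ cube c l ∧
    a (cube c l) = 0 ∧
    (∀ (x : EuclideanSpace ℝ (Fin d)) (t : ℝ), 0 < t →
      |t ^ (((d : ℝ) - β) / 2) * heat a t x| ≤ 1 / l ^ β) ∧
    a.totalVariation univ ≤ 1

/-- `μ` is the weak-star limit (against `C₀(ℝ^d)`) of the sums `∑_{i < n} c_{n,i} a_{n,i}` of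
`β`-atoms `a_{n,i}`. -/
def IsAtomicLimit {d : ℕ} (β : ℝ) (μ : SignedMeasure (EuclideanSpace ℝ (Fin d)))
    (c : ℕ → ℕ → ℝ) (a : ℕ → ℕ → SignedMeasure (EuclideanSpace ℝ (Fin d))) : Prop :=
  (∀ n, ∀ i < n, IsAtom β (a n i)) ∧
    ∀ φ : C₀(EuclideanSpace ℝ (Fin d), ℝ),
      Tendsto (fun n ↦ ∑ i ∈ Finset.range n, c n i * ∫ᵛ x, φ x ∂<•(a n i)) atTop
        (𝓝 (∫ᵛ x, φ x ∂<•μ))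

/-- `limsup_n ∑_{i < n} |c_{n,i}|`, as an extended nonnegative number. -/
def atomicCost (c : ℕ → ℕ → ℝ) : ℝ≥0∞ :=
  limsup (fun n ↦ ∑ i ∈ Finset.range n, ENNReal.ofReal |c n i|) atTop

/-- Membership in the atomic space `DS_β(ℝ^d)`. -/
def MemDS {d : ℕ} (β : ℝ) (μ : SignedMeasure (EuclideanSpace ℝ (Fin d))) : Prop :=
  ∃ c a, IsAtomicLimit β μ c a ∧ atomicCost c < ∞

/-- The norm of `DS_β(ℝ^d)` (it is finite exactly on `DS_β(ℝ^d)`). -/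
def dsNorm {d : ℕ} (β : ℝ) (μ : SignedMeasure (EuclideanSpace ℝ (Fin d))) : ℝ≥0∞ :=
  ⨅ (c) (a) (_ : IsAtomicLimit β μ c a), atomicCost c

/-! ### Riesz potential -/

/-- The integrand `t^{α/2-1} e^{tΔ} μ(x)` of the Riesz potential. -/
def rieszIntegrand {d : ℕ} (α : ℝ) (μ : SignedMeasure (EuclideanSpace ℝ (Fin d)))
    (x : EuclideanSpace ℝ (Fin d)) (t : ℝ) : ℝ :=
  t ^ (α / 2 - 1) * heat μ t x

/-- The Riesz potential `I_α μ (x) = Γ(α/2)⁻¹ ∫_0^∞ t^{α/2-1} e^{tΔ} μ(x) dt`. -/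
def rieszPotential {d : ℕ} (α : ℝ) (μ : SignedMeasure (EuclideanSpace ℝ (Fin d)))
    (x : EuclideanSpace ℝ (Fin d)) : ℝ :=
  1 / Real.Gamma (α / 2) * ∫ t in Ioi (0 : ℝ), rieszIntegrand α μ x t

/-! ### The Besov-Lorentz space -/

/-- The Lorentz `L^{p,1}` norm `p ∫_0^∞ |{|f| > s}|^{1/p} ds`, which equals
`∫_0^∞ t^{1/p} f^*(t) dt/t` for the decreasing rearrangement `f^*`. -/
def lorentzNorm {d : ℕ} (p : ℝ) (f : EuclideanSpace ℝ (Fin d) → ℂ) : ℝ≥0∞ :=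
  ENNReal.ofReal p * ∫⁻ s in Ioi (0 : ℝ), (volume {x | s < ‖f x‖}) ^ (1 / p)

/-- A Littlewood-Paley generator: a Schwartz function whose Fourier transform is compactly
supported and equal to `1` in a neighbourhood of the origin. -/
def IsLPGenerator {d : ℕ} (Ξ : 𝓢(EuclideanSpace ℝ (Fin d), ℂ)) : Prop :=
  HasCompactSupport (𝓕 Ξ : 𝓢(EuclideanSpace ℝ (Fin d), ℂ)) ∧
    ∀ᶠ ξ in 𝓝 (0 : EuclideanSpace ℝ (Fin d)),
      (𝓕 Ξ : 𝓢(EuclideanSpace ℝ (Fin d), ℂ)) ξ = 1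

/-- Littlewood-Paley generators exist. -/
theorem exists_isLPGenerator (d : ℕ) :
    ∃ Ξ : 𝓢(EuclideanSpace ℝ (Fin d), ℂ), IsLPGenerator Ξ := by
  let b : ContDiffBump (0 : EuclideanSpace ℝ (Fin d)) := ⟨1, 2, one_pos, one_lt_two⟩
  have h1 : HasCompactSupport (fun x ↦ ((b x : ℝ) : ℂ)) :=
    b.hasCompactSupport.comp_left (g := fun r : ℝ ↦ (r : ℂ)) (by simp)
  have h2 : ContDiff ℝ (⊤ : ℕ∞) (fun x ↦ ((b x : ℝ) : ℂ)) :=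
    Complex.ofRealCLM.contDiff.comp b.contDiff
  refine ⟨𝓕⁻ (h1.toSchwartzMap h2), ?_, ?_⟩
  · rw [FourierTransform.fourier_fourierInv_eq]
    exact h1
  · rw [FourierTransform.fourier_fourierInv_eq]
    filter_upwards [b.eventuallyEq_one] with x hx
    simp [hx]

/-- The linear isomorphism `y ↦ -2^k y`. -/
def negDilation (d : ℕ) (k : ℤ) :
    EuclideanSpace ℝ (Fin d) ≃L[ℝ] EuclideanSpace ℝ (Fin d) :=
  ContinuousLinearEquiv.smulLeft (Units.mk0 (-(2 : ℝ) ^ k) (neg_ne_zero.2 (by positivity)))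

/-- The Schwartz function `y ↦ Ξ_k(x - y)`, where `Ξ_k(z) = 2^{kd} Ξ(2^k z)`. -/
def lpKernel {d : ℕ} (Ξ : 𝓢(EuclideanSpace ℝ (Fin d), ℂ)) (k : ℤ)
    (x : EuclideanSpace ℝ (Fin d)) : 𝓢(EuclideanSpace ℝ (Fin d), ℂ) :=
  ((2 : ℂ) ^ (k * (d : ℤ))) •
    ((Ξ.compCLMOfContinuousLinearEquiv ℂ (negDilation d k)).compSubConstCLM ℂ x)

theorem lpKernel_apply {d : ℕ} (Ξ : 𝓢(EuclideanSpace ℝ (Fin d), ℂ)) (k : ℤ)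
    (x y : EuclideanSpace ℝ (Fin d)) :
    lpKernel Ξ k x y = (2 : ℂ) ^ (k * (d : ℤ)) * Ξ ((2 : ℝ) ^ k • (x - y)) := by
  have h : negDilation d k (y - x) = (2 : ℝ) ^ k • (x - y) := by
    change (-(2 : ℝ) ^ k) • (y - x) = _
    rw [neg_smul, ← smul_neg, neg_sub]
  simp [lpKernel, h]

/-- `P_{≤k} f = f * Ξ_k` for a tempered distribution `f`. -/
def lpLow {d : ℕ} (Ξ : 𝓢(EuclideanSpace ℝ (Fin d), ℂ)) (k : ℤ)
    (f : 𝓢'(EuclideanSpace ℝ (Fin d), ℂ)) (x : EuclideanSpace ℝ (Fin d)) : ℂ :=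
  f (lpKernel Ξ k x)

/-- The Littlewood-Paley projection `P_k f = P_{≤k} f - P_{≤k-1} f`. -/
def lpProj {d : ℕ} (Ξ : 𝓢(EuclideanSpace ℝ (Fin d), ℂ)) (k : ℤ)
    (f : 𝓢'(EuclideanSpace ℝ (Fin d), ℂ)) (x : EuclideanSpace ℝ (Fin d)) : ℂ :=
  lpLow Ξ k f x - lpLow Ξ (k - 1) f x

/-- The homogeneous Besov-Lorentz norm of `Ḃ^{0,1}_{p,1}(ℝ^d)`, that is `∑_k ‖P_k f‖_{L^{p,1}}`. -/
def besovLorentzNorm {d : ℕ} (Ξ : 𝓢(EuclideanSpace ℝ (Fin d), ℂ)) (p : ℝ)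
    (f : 𝓢'(EuclideanSpace ℝ (Fin d), ℂ)) : ℝ≥0∞ :=
  ∑' k : ℤ, lorentzNorm p (lpProj Ξ k f)

/-- The tempered distribution `T` is given by integration against the function `u`
(all the integrals being absolutely convergent). -/
def IsGivenBy {d : ℕ} (T : 𝓢'(EuclideanSpace ℝ (Fin d), ℂ))
    (u : EuclideanSpace ℝ (Fin d) → ℝ) : Prop :=
  ∀ g : 𝓢(EuclideanSpace ℝ (Fin d), ℂ),
    Integrable (fun x ↦ g x * (u x : ℂ)) ∧ T g = ∫ x, g x * (u x : ℂ)

end DSSpace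

end

/-! At scale R = 2^k the Littlewood-Paley piece of I_α μ is the convolution of μ with R^{d-α} Ψ(R
·), where Ψ is the Riesz potential of Ξ - 2^{-d} Ξ(·/2). The Fourier transform of this difference is
compactly supported and vanishes near 0. Hence the multiplier (4π²|ξ|²)^{-α/2} keeps Ψ Schwartz, and
a Gaussian may be divided out as well: Ψ = e^Δ Φ with Φ Schwartz (`exists_riesz_profile`).

Take one atom on a cube of side l and p = d/(d-α). The L^{p,1} norm of its piece is controlled by
(L¹ norm)^{1/p} (L^∞ norm)^{1-1/p}. If Rl ≤ 1, the zero mass of the atom gains a factor Rl in both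
norms. If Rl > 1, the L¹ norm is O(R^{-α}), and Ψ = e^Δ Φ turns the convolution into R^{-α} times an
average, weighted by Φ, of the heat extension of the atom at time R^{-2}, which the atom condition
bounds by R^{d-β} l^{-β}. For this p the remaining powers of R combine to min(Rl, (Rl)^{-αβ/d})
(`exists_atom_bounds`). Since β > 0, the sum over dyadic R is geometric on both sides and bounded
uniformly in l (`exists_tsum_min_le`).

`lorentzNorm_sum_le` carries this to finite combinations of atoms. For fixed k and x the kernel is a
C₀ test function of y, so the pieces of the atomic sums converge pointwise to the piece of μ.
Fatou's lemma, for the Lorentz norm and for the sum over k, then gives the bound for every atomic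
limit. -/

noncomputable section

namespace DSSpace

variable {d : ℕ}

/-! ### Integration against a signed measure -/

/-- The integral of a vector-valued function against a signed measure, via its Jordan
decomposition. -/
def pairing {X F : Type*} [MeasurableSpace X] [NormedAddCommGroup F] [NormedSpace ℝ F]
    (μ : SignedMeasure X) (f : X → F) : F :=
  ∫ x, f x ∂μ.toJordanDecomposition.posPart - ∫ x, f x ∂μ.toJordanDecomposition.negPart

/-- This passes to ordinary Bochner integrals against two finite positive measures, where Fubini and
domination are available. -/
theorem integral_eq_pairing {X F : Type*} [MeasurableSpace X] [NormedAddCommGroup F]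
    [NormedSpace ℝ F] (μ : SignedMeasure X) {f : X → F}
    (hf : Integrable f μ.totalVariation) :
    ∫ᵛ x, f x ∂<•μ = pairing μ f := by
  have h := SignedMeasure.toSignedMeasure_toJordanDecomposition μ
  conv_lhs => rw [← h]
  rw [SignedMeasure.totalVariation, integrable_add_measure] at hf
  rw [JordanDecomposition.toSignedMeasure, VectorMeasure.integral_sub_vectorMeasure,
    VectorMeasure.integral_toSignedMeasure, VectorMeasure.integral_toSignedMeasure]
  · rfl
  · simpa [VectorMeasure.Integrable] using hf.1
  · simpa [VectorMeasure.Integrable] using hf.2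

theorem pairing_const {X F : Type*} [MeasurableSpace X] [NormedAddCommGroup F]
    [NormedSpace ℝ F] [CompleteSpace F] (μ : SignedMeasure X) (c : F) :
    pairing μ (fun _ ↦ c) = (μ univ) • c := by
  rw [pairing, integral_const, integral_const, ← sub_smul,
    SignedMeasure.apply_eq_posPart_real_sub_negPart_real μ MeasurableSet.univ]

/-! ### The Lorentz norm -/

theorem measurable_distribution {X : Type*} [MeasurableSpace X] (m : Measure X) (f : X → ℝ) :
    Measurable fun s : ℝ ↦ m {x | s < f x} := by
  have h : Antitone fun s : ℝ ↦ m {x | s < f x} := fun s t hst ↦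
    measure_mono fun x hx ↦ lt_of_le_of_lt hst hx
  exact h.measurable

/-- Fatou's lemma for indicators: the strict inequality s < f x is inherited by F n x for all large
n. -/
theorem measure_lt_le_liminf {X : Type*} [MeasurableSpace X] (m : Measure X)
    {f : X → ℝ} {F : ℕ → X → ℝ} (hF : ∀ n, Measurable (F n))
    (h : ∀ x, Tendsto (fun n ↦ F n x) atTop (𝓝 (f x))) (s : ℝ) :
    m {x | s < f x} ≤ liminf (fun n ↦ m {x | s < F n x}) atTop := by
  have hm : ∀ n, MeasurableSet {x | s < F n x} := fun n ↦ measurableSet_lt measurable_const (hF n)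
  have hf : Measurable f := measurable_of_tendsto_metrizable hF (tendsto_pi_nhds.2 h)
  calc m {x | s < f x} = ∫⁻ x, {x | s < f x}.indicator 1 x ∂m :=
        (lintegral_indicator_one (measurableSet_lt measurable_const hf)).symm
    _ ≤ ∫⁻ x, liminf (fun n ↦ {x | s < F n x}.indicator (1 : X → ℝ≥0∞) x) atTop ∂m := by
        refine lintegral_mono fun x ↦ ?_
        by_cases hx : s < f x
        · refine le_liminf_of_le (by isBoundedDefault) ?_
          filter_upwards [(h x).eventually_const_lt hx] with n hn
          simp [indicator, hx, hn]
        · simp [indicator, hx]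
    _ ≤ liminf (fun n ↦ ∫⁻ x, {x | s < F n x}.indicator 1 x ∂m) atTop :=
        lintegral_liminf_le fun n ↦ measurable_one.indicator (hm n)
    _ = _ := by simp_rw [fun n ↦ lintegral_indicator_one (μ := m) (hm n)]

theorem ennreal_rpow_liminf {u : ℕ → ℝ≥0∞} {q : ℝ} (hq : 0 < q) :
    (liminf u atTop) ^ q = liminf (fun n ↦ u n ^ q) atTop :=
  (ENNReal.orderIsoRpow q hq).liminf_apply

/-- Lower semicontinuity by Fatou twice, once in x for the distribution function and once in the
level s; the increasing power 1/p commutes with liminf. -/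
theorem lorentzNorm_le_liminf {p : ℝ} (hp : 0 < p) {f : EuclideanSpace ℝ (Fin d) → ℂ}
    {F : ℕ → EuclideanSpace ℝ (Fin d) → ℂ} (hF : ∀ n, Measurable (F n))
    (h : ∀ x, Tendsto (fun n ↦ F n x) atTop (𝓝 (f x))) :
    lorentzNorm p f ≤ liminf (fun n ↦ lorentzNorm p (F n)) atTop := by
  unfold lorentzNorm
  calc _ ≤ ENNReal.ofReal p * liminf (fun n ↦ ∫⁻ s in Ioi (0 : ℝ),
          (volume {x | s < ‖F n x‖}) ^ (1 / p)) atTop := by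
        gcongr
        refine (lintegral_mono fun s ↦ ?_).trans
          (lintegral_liminf_le fun n ↦ (measurable_distribution _ _).pow_const _)
        rw [← ennreal_rpow_liminf (by positivity)]
        gcongr
        exact measure_lt_le_liminf _ (fun n ↦ (hF n).norm) (fun x ↦ (h x).norm) s
    _ = _ := by
        rw [ENNReal.liminf_const_mul_of_ne_top ENNReal.ofReal_ne_top]

/-- `∫_0^∞ u^{1/p-1} min(A/u, M) du ≤ (p + p/(p-1)) A^{1/p} M^{1-1/p}`. -/
theorem lintegral_rpow_mul_min_le {p A M : ℝ} (hp : 1 < p) (hA : 0 < A) (hM : 0 < M) :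
    ∫⁻ u in Ioi (0 : ℝ), ENNReal.ofReal (u ^ (1 / p - 1) * min (A / u) M) ≤
      ENNReal.ofReal ((p + p / (p - 1)) * (A ^ (1 / p) * M ^ (1 - 1 / p))) := by
  have hp0 : 0 < p := by linarith
  have hp1 : 1 / p < 1 := by rw [div_lt_one hp0]; exact hp
  have hpp : 0 < 1 / p := by positivity
  -- The two branches of the minimum cross at u = A/M. Below it M u^{1/p-1} is integrable at 0,
  -- above it A u^{1/p-2} is integrable at infinity because p > 1.
  have hr : 0 < A / M := by positivity
  have h1 : ∫⁻ u in Ioc 0 (A / M), ENNReal.ofReal (u ^ (1 / p - 1) * min (A / u) M) ≤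
      ENNReal.ofReal (p * (A ^ (1 / p) * M ^ (1 - 1 / p))) := by
    have hi : IntegrableOn (fun u : ℝ ↦ u ^ (1 / p - 1)) (Ioc 0 (A / M)) :=
      (intervalIntegral.intervalIntegrable_rpow' (by linarith)).1
    calc _ ≤ ∫⁻ u in Ioc 0 (A / M), ENNReal.ofReal (M * u ^ (1 / p - 1)) := by
          refine setLIntegral_mono' measurableSet_Ioc fun u hu ↦ ENNReal.ofReal_le_ofReal ?_
          rw [mul_comm M]
          exact mul_le_mul_of_nonneg_left (min_le_right _ _) (Real.rpow_nonneg hu.1.le _)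
      _ = ENNReal.ofReal (∫ u in Ioc 0 (A / M), M * u ^ (1 / p - 1)) := by
          refine (ofReal_integral_eq_lintegral_ofReal (hi.const_mul M) ?_).symm
          filter_upwards [ae_restrict_mem measurableSet_Ioc] with u hu
          exact mul_nonneg hM.le (Real.rpow_nonneg hu.1.le _)
      _ = _ := by
          rw [integral_const_mul, ← intervalIntegral.integral_of_le hr.le,
            integral_rpow (Or.inl (by linarith)), sub_add_cancel, Real.zero_rpow hpp.ne',
            Real.div_rpow hA.le hM.le, Real.rpow_sub hM, Real.rpow_one]
          congr 1
          field_simp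
          simp
  have h2 : ∫⁻ u in Ioi (A / M), ENNReal.ofReal (u ^ (1 / p - 1) * min (A / u) M) ≤
      ENNReal.ofReal (p / (p - 1) * (A ^ (1 / p) * M ^ (1 - 1 / p))) := by
    have hi : IntegrableOn (fun u : ℝ ↦ u ^ (1 / p - 2)) (Ioi (A / M)) :=
      integrableOn_Ioi_rpow_of_lt (by linarith) hr
    calc _ ≤ ∫⁻ u in Ioi (A / M), ENNReal.ofReal (A * u ^ (1 / p - 2)) := by
          refine setLIntegral_mono' measurableSet_Ioi fun u hu ↦ ENNReal.ofReal_le_ofReal ?_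
          have hu0 : 0 < u := hr.trans hu
          calc _ ≤ u ^ (1 / p - 1) * (A / u) :=
                mul_le_mul_of_nonneg_left (min_le_left _ _) (Real.rpow_nonneg hu0.le _)
            _ = _ := by
                rw [show 1 / p - 2 = 1 / p - 1 - 1 by ring, Real.rpow_sub_one hu0.ne' (1 / p - 1)]
                field_simp
      _ = ENNReal.ofReal (∫ u in Ioi (A / M), A * u ^ (1 / p - 2)) := by
          refine (ofReal_integral_eq_lintegral_ofReal (hi.const_mul A) ?_).symm
          filter_upwards [ae_restrict_mem measurableSet_Ioi] with u hu
          exact mul_nonneg hA.le (Real.rpow_nonneg (hr.trans hu).le _)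
      _ = _ := by
          rw [integral_const_mul, integral_Ioi_rpow_of_lt (by linarith) hr,
            show 1 / p - 2 + 1 = 1 / p - 1 by ring,
            Real.div_rpow hA.le hM.le, Real.rpow_sub hM, Real.rpow_sub hA, Real.rpow_sub hM,
            Real.rpow_one, Real.rpow_one]
          congr 1
          have : p - 1 ≠ 0 := by linarith
          have : 1 - p ≠ 0 := by linarith
          have : A ^ (1/p) ≠ 0 := (Real.rpow_pos_of_pos hA _).ne'
          have : M ^ (1/p) ≠ 0 := (Real.rpow_pos_of_pos hM _).ne'
          rw [show 1 / p - 1 = -((p - 1) / p) by field_simp; ring]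
          field_simp
  rw [← Ioc_union_Ioi_eq_Ioi hr.le, lintegral_union measurableSet_Ioi (Ioc_disjoint_Ioi le_rfl),
    add_mul, ENNReal.ofReal_add (by positivity)
      (mul_nonneg (div_nonneg hp0.le (by linarith)) (by positivity))]
  exact add_le_add h1 h2

/-- This is D^q = q ∫_0^D u^{q-1} du. The indicator form prepares an exchange of integrals when D is
a distribution function. -/
theorem rpow_le_lintegral {q : ℝ} (hq : 0 < q) {D : ℝ≥0∞} (hD : D ≠ ∞) :
    D ^ q ≤ ENNReal.ofReal q *
      ∫⁻ u in Ioi (0 : ℝ), {u : ℝ | ENNReal.ofReal u < D}.indicator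
        (fun u ↦ ENNReal.ofReal (u ^ (q - 1))) u := by
  lift D to NNReal using hD
  have hi : IntegrableOn (fun u : ℝ ↦ u ^ (q - 1)) (Ioc 0 (D : ℝ)) :=
    (intervalIntegral.intervalIntegrable_rpow' (by linarith)).1
  have h1 : ∫⁻ u in Ioo 0 (D : ℝ), ENNReal.ofReal (u ^ (q - 1)) =
      ENNReal.ofReal ((D : ℝ) ^ q / q) := by
    replace hi := hi.mono_set Ioo_subset_Ioc_self
    rw [← ofReal_integral_eq_lintegral_ofReal hi, ← integral_Ioc_eq_integral_Ioo,
      ← intervalIntegral.integral_of_le (NNReal.coe_nonneg D), integral_rpow (Or.inl (by linarith)),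
      sub_add_cancel, Real.zero_rpow hq.ne', sub_zero]
    filter_upwards [ae_restrict_mem measurableSet_Ioo] with u hu
    exact Real.rpow_nonneg hu.1.le _
  have h2 : ∫⁻ u in Ioo 0 (D : ℝ), ENNReal.ofReal (u ^ (q - 1)) ≤
      ∫⁻ u in Ioi (0 : ℝ), {u : ℝ | ENNReal.ofReal u < D}.indicator
        (fun u ↦ ENNReal.ofReal (u ^ (q - 1))) u := by
    rw [← lintegral_indicator measurableSet_Ioo, ← lintegral_indicator measurableSet_Ioi]
    refine lintegral_mono fun u ↦ ?_
    by_cases hu : u ∈ Ioo 0 (D : ℝ)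
    · have : ENNReal.ofReal u < D := by
        rw [← ENNReal.ofReal_coe_nnreal]
        exact (ENNReal.ofReal_lt_ofReal_iff (hu.1.trans hu.2)).2 hu.2
      have h0 : u ∈ Ioi (0 : ℝ) := hu.1
      simp only [indicator, hu, h0, if_true, mem_ofPred_eq, this, le_refl]
    · simp [indicator_of_notMem hu]
  calc (D : ℝ≥0∞) ^ q = ENNReal.ofReal q * ENNReal.ofReal ((D : ℝ) ^ q / q) := by
        rw [← ENNReal.ofReal_mul hq.le, mul_div_cancel₀ _ hq.ne',
          ← ENNReal.ofReal_rpow_of_nonneg (NNReal.coe_nonneg D) hq.le, ENNReal.ofReal_coe_nnreal]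
    _ ≤ _ := by gcongr; exact h1 ▸ h2

/-- Hypothesis `hb` says that b dominates the decreasing rearrangement of f. Writing the power 1/p
of the distribution function as an integral in u and applying Tonelli leaves, for each u, a set of
levels s contained in (0, b u). -/
theorem lorentzNorm_le_of_distribution_le {p : ℝ} (hp : 0 < p)
    {f : EuclideanSpace ℝ (Fin d) → ℂ} {b : ℝ → ℝ}
    (hfin : ∀ s, 0 < s → volume {x | s < ‖f x‖} ≠ ∞)
    (hb : ∀ u, 0 < u → volume {x | b u < ‖f x‖} ≤ ENNReal.ofReal u) :
    lorentzNorm p f ≤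
      ∫⁻ u in Ioi (0 : ℝ), ENNReal.ofReal (u ^ (1 / p - 1)) * ENNReal.ofReal (b u) := by
  have hq : 0 < 1 / p := by positivity
  have hmeas : Measurable fun z : ℝ × ℝ ↦
      {u : ℝ | ENNReal.ofReal u < volume {x | z.1 < ‖f x‖}}.indicator
        (fun u ↦ ENNReal.ofReal (u ^ (1 / p - 1))) z.2 := by
    have : Measurable ({z : ℝ × ℝ | ENNReal.ofReal z.2 < volume {x | z.1 < ‖f x‖}}.indicator
        (fun z ↦ ENNReal.ofReal (z.2 ^ (1 / p - 1)))) := by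
      refine Measurable.indicator (by fun_prop) (measurableSet_lt (by fun_prop) ?_)
      exact (measurable_distribution volume fun x ↦ ‖f x‖).comp measurable_fst
    exact this
  calc lorentzNorm p f ≤ ENNReal.ofReal p * ∫⁻ s in Ioi (0 : ℝ), ENNReal.ofReal (1 / p) *
        ∫⁻ u in Ioi (0 : ℝ), {u : ℝ | ENNReal.ofReal u < volume {x | s < ‖f x‖}}.indicator
          (fun u ↦ ENNReal.ofReal (u ^ (1 / p - 1))) u := by
        unfold lorentzNorm
        gcongr ENNReal.ofReal p * ?_
        exact setLIntegral_mono' measurableSet_Ioi fun s hs ↦ rpow_le_lintegral hq (hfin s hs)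
    _ = ∫⁻ u in Ioi (0 : ℝ), ∫⁻ s in Ioi (0 : ℝ),
        {u : ℝ | ENNReal.ofReal u < volume {x | s < ‖f x‖}}.indicator
          (fun u ↦ ENNReal.ofReal (u ^ (1 / p - 1))) u := by
        rw [lintegral_const_mul' _ _ ENNReal.ofReal_ne_top, ← mul_assoc,
          ← ENNReal.ofReal_mul hp.le, mul_one_div_cancel hp.ne', ENNReal.ofReal_one, one_mul]
        exact lintegral_lintegral_swap hmeas.aemeasurable
    _ ≤ _ := by
        refine setLIntegral_mono' measurableSet_Ioi fun u hu ↦ ?_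
        calc _ ≤ ∫⁻ s in Ioi (0 : ℝ), (Ioo 0 (b u)).indicator
                (fun _ ↦ ENNReal.ofReal (u ^ (1 / p - 1))) s := by
              refine setLIntegral_mono' measurableSet_Ioi fun s hs ↦ ?_
              by_cases h : ENNReal.ofReal u < volume {x | s < ‖f x‖}
              · have hsb : s ∈ Ioo 0 (b u) := by
                  refine ⟨hs, ?_⟩
                  by_contra! hc
                  exact absurd (h.trans_le ((measure_mono fun x hx ↦ lt_of_le_of_lt hc hx).trans
                    (hb u hu))) (lt_irrefl _)
                simp [indicator, hsb.1, hsb.2, h]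
              · simp [indicator, h]
          _ ≤ ∫⁻ s, (Ioo 0 (b u)).indicator
                (fun _ ↦ ENNReal.ofReal (u ^ (1 / p - 1))) s := setLIntegral_le_lintegral _ _
          _ = _ := by
              rw [lintegral_indicator_const measurableSet_Ioo, Real.volume_Ioo, sub_zero]

/-- The `L^{p,1}` norm of a linear combination of functions in `L¹ ∩ L^∞`. -/
theorem lorentzNorm_sum_le {ι : Type*} {p : ℝ} (hp : 1 < p) (s : Finset ι)
    {f : ι → EuclideanSpace ℝ (Fin d) → ℂ} (hf : ∀ i ∈ s, Measurable (f i)) {A M : ι → ℝ}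
    (hA : ∀ i ∈ s, 0 < A i) (hM : ∀ i ∈ s, 0 < M i) (c : ι → ℝ)
    (hfA : ∀ i ∈ s, ∫⁻ x, ‖f i x‖ₑ ≤ ENNReal.ofReal (A i))
    (hfM : ∀ i ∈ s, ∀ x, ‖f i x‖ ≤ M i) :
    lorentzNorm p (fun x ↦ ∑ i ∈ s, (c i : ℂ) * f i x) ≤
      ∑ i ∈ s, ENNReal.ofReal |c i| *
        ENNReal.ofReal (2 * (p + p / (p - 1)) * (A i ^ (1 / p) * M i ^ (1 - 1 / p))) := by
  have hp0 : 0 < p := by linarith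
  have hL1 : ∀ t ⊆ s, ∫⁻ x, ENNReal.ofReal (∑ i ∈ t, |c i| * ‖f i x‖) ≤
      ENNReal.ofReal (∑ i ∈ t, |c i| * A i) := fun t ht ↦ by
    have h1 : ∀ x, ENNReal.ofReal (∑ i ∈ t, |c i| * ‖f i x‖) =
        ∑ i ∈ t, ENNReal.ofReal |c i| * ‖f i x‖ₑ := fun x ↦ by
      rw [ENNReal.ofReal_sum_of_nonneg fun i _ ↦ by positivity]
      simp_rw [ENNReal.ofReal_mul (abs_nonneg _), ofReal_norm]
    simp_rw [h1]
    rw [lintegral_finsetSum' _ fun i hi ↦ ((hf i (ht hi)).enorm.const_mul _).aemeasurable,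
      ENNReal.ofReal_sum_of_nonneg fun i hi ↦ mul_nonneg (abs_nonneg _) (hA i (ht hi)).le]
    refine Finset.sum_le_sum fun i hi ↦ ?_
    rw [lintegral_const_mul _ (hf i (ht hi)).enorm, ENNReal.ofReal_mul (abs_nonneg _)]
    gcongr
    exact hfA i (ht hi)
  have hG : ∀ t ⊆ s, Measurable fun x ↦ ∑ i ∈ t, |c i| * ‖f i x‖ := fun t ht ↦
    Finset.measurable_sum _ fun i hi ↦ (hf i (ht hi)).norm.const_mul _
  have hFG : ∀ x, ‖∑ i ∈ s, (c i : ℂ) * f i x‖ ≤ ∑ i ∈ s, |c i| * ‖f i x‖ := fun x ↦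
    (norm_sum_le _ _).trans_eq (by simp)
  have hcheb : ∀ t ⊆ s, ∀ r : ℝ, 0 < r → volume {x | r < ∑ i ∈ t, |c i| * ‖f i x‖} ≤
      ENNReal.ofReal (∑ i ∈ t, |c i| * A i) / ENNReal.ofReal r := fun t ht r hr ↦ by
    refine (measure_mono ?_).trans ((meas_ge_le_lintegral_div
      (hG t ht).ennreal_ofReal.aemeasurable (ENNReal.ofReal_pos.2 hr).ne'
      ENNReal.ofReal_ne_top).trans (ENNReal.div_le_div_right (hL1 t ht) _))
    exact fun x hx ↦ ENNReal.ofReal_le_ofReal (le_of_lt hx)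
  -- The rearrangement of the sum at u is bounded by 2 B(u). Terms with M_i < A_i/u add up to at
  -- most B(u) pointwise; the others have total L¹ norm at most u B(u), so Chebyshev at level B(u)
  -- costs measure at most u.
  let B : ℝ → ℝ := fun u ↦ ∑ i ∈ s, |c i| * min (A i / u) (M i)
  have hfin : ∀ r, 0 < r → volume {x | r < ‖∑ i ∈ s, (c i : ℂ) * f i x‖} ≠ ∞ := fun r hr ↦ by
    refine ne_top_of_le_ne_top ?_ ((measure_mono fun x hx ↦ ?_).trans (hcheb s subset_rfl r hr))
    · exact ENNReal.div_ne_top ENNReal.ofReal_ne_top (ENNReal.ofReal_pos.2 hr).ne'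
    · exact lt_of_lt_of_le hx (hFG x)
  have hB : ∀ u, 0 < u → volume {x | 2 * B u < ‖∑ i ∈ s, (c i : ℂ) * f i x‖} ≤
      ENNReal.ofReal u := fun u hu ↦ by
    have hB0 : ∀ i ∈ s, 0 ≤ |c i| * min (A i / u) (M i) := fun i hi ↦
      mul_nonneg (abs_nonneg _) (le_min (div_nonneg (hA i hi).le hu.le) (hM i hi).le)
    classical
    let t := s.filter fun i ↦ A i / u ≤ M i
    have ht : t ⊆ s := Finset.filter_subset _ _
    have htB : ∑ i ∈ t, |c i| * A i ≤ u * B u := by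
      calc ∑ i ∈ t, |c i| * A i = ∑ i ∈ t, u * (|c i| * min (A i / u) (M i)) := by
            refine Finset.sum_congr rfl fun i hi ↦ ?_
            rw [min_eq_left (Finset.mem_filter.1 hi).2]
            field_simp
        _ = u * ∑ i ∈ t, |c i| * min (A i / u) (M i) := by rw [Finset.mul_sum]
        _ ≤ _ := mul_le_mul_of_nonneg_left
            (Finset.sum_le_sum_of_subset_of_nonneg ht fun i hi _ ↦ hB0 i hi) hu.le
    have hsplit : ∀ x, ∑ i ∈ s, |c i| * ‖f i x‖ ≤ ∑ i ∈ t, |c i| * ‖f i x‖ + B u := fun x ↦ by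
      rw [← Finset.sum_filter_add_sum_filter_not s (fun i ↦ A i / u ≤ M i)]
      refine add_le_add le_rfl ?_
      calc _ ≤ ∑ i ∈ s with ¬ A i / u ≤ M i, |c i| * min (A i / u) (M i) := by
            refine Finset.sum_le_sum fun i hi ↦ mul_le_mul_of_nonneg_left ?_ (abs_nonneg _)
            rw [min_eq_right (not_le.1 (Finset.mem_filter.1 hi).2).le]
            exact hfM i (Finset.mem_filter.1 hi).1 x
        _ ≤ _ := Finset.sum_le_sum_of_subset_of_nonneg (Finset.filter_subset _ _)
            fun i hi _ ↦ hB0 i hi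
    have hsub : {x | 2 * B u < ‖∑ i ∈ s, (c i : ℂ) * f i x‖} ⊆
        {x | B u < ∑ i ∈ t, |c i| * ‖f i x‖} := fun x hx ↦ by
      have h1 : 2 * B u < ‖∑ i ∈ s, (c i : ℂ) * f i x‖ := hx
      have h2 := (hFG x).trans (hsplit x)
      change B u < ∑ i ∈ t, |c i| * ‖f i x‖
      linarith
    refine (measure_mono hsub).trans ?_
    -- Chebyshev needs a positive level. If B(u) = 0, the terms in t have zero L¹ norm and their sum
    -- vanishes almost everywhere.
    rcases (Finset.sum_nonneg hB0).eq_or_lt' with h0 | h0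
    · change B u = 0 at h0
      have h00 : ∫⁻ x, ENNReal.ofReal (∑ i ∈ t, |c i| * ‖f i x‖) = 0 := by
        refine le_antisymm ((hL1 t ht).trans ?_) zero_le
        rw [nonpos_iff_eq_zero, ENNReal.ofReal_eq_zero]
        simpa [h0] using htB
      rw [lintegral_eq_zero_iff (hG t ht).ennreal_ofReal] at h00
      have : volume {x | B u < ∑ i ∈ t, |c i| * ‖f i x‖} = 0 := by
        refine measure_mono_null (fun x hx ↦ ?_) h00
        have hx' : 0 < ∑ i ∈ t, |c i| * ‖f i x‖ := h0 ▸ hx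
        simpa using hx'
      simp [this]
    · change 0 < B u at h0
      refine (hcheb t ht _ h0).trans ?_
      rw [← ENNReal.ofReal_div_of_pos h0]
      refine ENNReal.ofReal_le_ofReal ?_
      rw [div_le_iff₀ h0]
      exact htB
  refine (lorentzNorm_le_of_distribution_le hp0 hfin hB).trans ?_
  calc ∫⁻ u in Ioi (0 : ℝ), ENNReal.ofReal (u ^ (1 / p - 1)) * ENNReal.ofReal (2 * B u)
      = ∫⁻ u in Ioi (0 : ℝ), ∑ i ∈ s, ENNReal.ofReal |c i| * (ENNReal.ofReal 2 *
          ENNReal.ofReal (u ^ (1 / p - 1) * min (A i / u) (M i))) := by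
        refine setLIntegral_congr_fun measurableSet_Ioi fun u hu ↦ ?_
        have hu' : 0 ≤ u := (mem_Ioi.1 hu).le
        have hm : ∀ i ∈ s, 0 ≤ min (A i / u) (M i) := fun i hi ↦
          le_min (div_nonneg (hA i hi).le hu') (hM i hi).le
        have hr : 0 ≤ u ^ (1 / p - 1) := Real.rpow_nonneg hu' _
        rw [← ENNReal.ofReal_mul hr, Finset.mul_sum, Finset.mul_sum,
          ENNReal.ofReal_sum_of_nonneg fun i hi ↦ mul_nonneg hr
            (mul_nonneg zero_le_two (mul_nonneg (abs_nonneg _) (hm i hi)))]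
        refine Finset.sum_congr rfl fun i hi ↦ ?_
        rw [← ENNReal.ofReal_mul zero_le_two, ← ENNReal.ofReal_mul (abs_nonneg _)]
        congr 1
        ring
    _ ≤ _ := by
        rw [lintegral_finsetSum _ fun i _ ↦ by fun_prop]
        refine Finset.sum_le_sum fun i hi ↦ ?_
        rw [lintegral_const_mul _ (by fun_prop), lintegral_const_mul _ (by fun_prop),
          mul_assoc 2, ENNReal.ofReal_mul zero_le_two]
        gcongr
        exact lintegral_rpow_mul_min_le hp (hA i hi) (hM i hi)

/-! ### The heat kernel -/

theorem heatKernel_nonneg {t : ℝ} (ht : 0 < t) (x : EuclideanSpace ℝ (Fin d)) :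
    0 ≤ heatKernel d t x := by
  unfold heatKernel; positivity

theorem heatKernel_le {t : ℝ} (ht : 0 < t) (x : EuclideanSpace ℝ (Fin d)) :
    heatKernel d t x ≤ (4 * Real.pi * t) ^ (-((d : ℝ) / 2)) := by
  unfold heatKernel
  refine mul_le_of_le_one_right (by positivity) (Real.exp_le_one_iff.2 ?_)
  rw [neg_div]
  exact neg_nonpos.2 (by positivity)

@[fun_prop]
theorem measurable_heatKernel :
    Measurable fun z : ℝ × EuclideanSpace ℝ (Fin d) ↦ heatKernel d z.1 z.2 := by
  unfold heatKernel; fun_prop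

theorem continuous_heatKernel (t : ℝ) : Continuous (heatKernel d t) := by
  unfold heatKernel; fun_prop

theorem heatKernel_eq (t : ℝ) (x : EuclideanSpace ℝ (Fin d)) :
    heatKernel d t x = (4 * Real.pi * t) ^ (-((d : ℝ) / 2)) * Real.exp (-(1 / (4 * t)) * ‖x‖ ^ 2) := by
  unfold heatKernel
  congr 2
  ring

theorem integrable_heatKernel {t : ℝ} (ht : 0 < t) : Integrable (heatKernel d t) := by
  have h := (GaussianFourier.integrable_cexp_neg_mul_sq_norm_add
    (V := EuclideanSpace ℝ (Fin d)) (b := ((1 / (4 * t) : ℝ) : ℂ))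
    (by rw [Complex.ofReal_re]; positivity) 0 0).norm
  refine (h.const_mul ((4 * Real.pi * t) ^ (-((d : ℝ) / 2)))).congr (.of_forall fun x ↦ ?_)
  simp only
  rw [heatKernel_eq, Complex.norm_exp]
  congr 2
  simp [← Complex.ofReal_pow]

theorem integral_heatKernel {t : ℝ} (ht : 0 < t) : ∫ x, heatKernel d t x = 1 := by
  simp_rw [heatKernel_eq]
  rw [integral_const_mul, GaussianFourier.integral_rexp_neg_mul_sq_norm (by positivity),
    finrank_euclideanSpace_fin, show Real.pi / (1 / (4 * t)) = 4 * Real.pi * t by field_simp,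
    ← Real.rpow_add (by positivity), neg_add_cancel, Real.rpow_zero]

theorem lintegral_heatKernel_sub {t : ℝ} (ht : 0 < t) (y : EuclideanSpace ℝ (Fin d)) :
    ∫⁻ x, ENNReal.ofReal (heatKernel d t (x - y)) = 1 := by
  rw [lintegral_sub_right_eq_self (fun x ↦ ENNReal.ofReal (heatKernel d t x)) y,
    ← ofReal_integral_eq_lintegral_ofReal (integrable_heatKernel ht)
      (.of_forall (heatKernel_nonneg ht)), integral_heatKernel ht, ENNReal.ofReal_one]

/-- The Riesz potential is bounded from `L¹ ∩ L^∞` to `L^∞`. -/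
theorem exists_lintegral_rpow_mul_heat_le {α : ℝ} (hα : 0 < α) (hαd : α < d) :
    ∃ K : ℝ, 0 ≤ K ∧ ∀ (g : EuclideanSpace ℝ (Fin d) → ℝ≥0∞) (S : ℝ≥0∞), (∀ x, g x ≤ S) →
      ∀ y, ∫⁻ t in Ioi (0 : ℝ), ∫⁻ x,
          ENNReal.ofReal (t ^ (α / 2 - 1) * heatKernel d t (x - y)) * g x ≤
        ENNReal.ofReal K * (S + ∫⁻ x, g x) := by
  -- For t ≤ 1 the unit mass of the heat kernel is paired with the bound S, and α > 0 gives
  -- integrability at 0. For t > 1 the kernel is at most (4πt)^{-d/2}, paired with the L¹ norm of g,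
  -- and α < d gives integrability at infinity.
  have i1 : IntegrableOn (fun t : ℝ ↦ t ^ (α / 2 - 1)) (Ioc 0 1) :=
    (intervalIntegral.intervalIntegrable_rpow' (by linarith)).1
  have i2 : IntegrableOn (fun t : ℝ ↦ (4 * Real.pi) ^ (-((d : ℝ) / 2)) *
      t ^ (α / 2 - 1 + -((d : ℝ) / 2))) (Ioi 1) :=
    (integrableOn_Ioi_rpow_of_lt (by linarith) one_pos).const_mul _
  have h1 : ∫⁻ t in Ioc (0 : ℝ) 1, ENNReal.ofReal (t ^ (α / 2 - 1)) ≤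
      ENNReal.ofReal (∫ t in Ioc (0 : ℝ) 1, t ^ (α / 2 - 1)) := by
    rw [ofReal_integral_eq_lintegral_ofReal i1]
    filter_upwards [ae_restrict_mem measurableSet_Ioc] with t ht
    exact Real.rpow_nonneg ht.1.le _
  have h2 : ∫⁻ t in Ioi (1 : ℝ), ENNReal.ofReal ((4 * Real.pi) ^ (-((d : ℝ) / 2)) *
      t ^ (α / 2 - 1 + -((d : ℝ) / 2))) ≤
      ENNReal.ofReal (∫ t in Ioi (1 : ℝ), (4 * Real.pi) ^ (-((d : ℝ) / 2)) *
      t ^ (α / 2 - 1 + -((d : ℝ) / 2))) := by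
    rw [ofReal_integral_eq_lintegral_ofReal i2]
    filter_upwards [ae_restrict_mem measurableSet_Ioi] with t ht
    have : (0 : ℝ) < t := one_pos.trans ht
    positivity
  set K1 := ∫ t in Ioc (0 : ℝ) 1, t ^ (α / 2 - 1)
  set K2 := ∫ t in Ioi (1 : ℝ), (4 * Real.pi) ^ (-((d : ℝ) / 2)) *
      t ^ (α / 2 - 1 + -((d : ℝ) / 2))
  refine ⟨max (max K1 K2) 0, le_max_right _ _, fun g S hg y ↦ ?_⟩
  rw [← Ioc_union_Ioi_eq_Ioi (zero_le_one' ℝ),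
    lintegral_union measurableSet_Ioi (Ioc_disjoint_Ioi le_rfl), mul_add]
  refine add_le_add ?_ ?_
  · calc _ ≤ ∫⁻ t in Ioc (0 : ℝ) 1, ENNReal.ofReal (t ^ (α / 2 - 1)) * S := by
          refine setLIntegral_mono' measurableSet_Ioc fun t ht ↦ ?_
          calc _ ≤ ∫⁻ x, ENNReal.ofReal (t ^ (α / 2 - 1)) * S *
                ENNReal.ofReal (heatKernel d t (x - y)) := by
                refine lintegral_mono fun x ↦ ?_
                rw [ENNReal.ofReal_mul (Real.rpow_nonneg ht.1.le _), mul_right_comm]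
                gcongr
                exact hg x
            _ = _ := by
                rw [lintegral_const_mul _ (by
                  exact ((continuous_heatKernel t).measurable.comp
                    (measurable_id.sub_const y)).ennreal_ofReal),
                  lintegral_heatKernel_sub ht.1, mul_one]
      _ = (∫⁻ t in Ioc (0 : ℝ) 1, ENNReal.ofReal (t ^ (α / 2 - 1))) * S :=
          lintegral_mul_const _ (by fun_prop)
      _ ≤ _ := by
          gcongr
          exact h1.trans (ENNReal.ofReal_le_ofReal ((le_max_left _ _).trans (le_max_left _ _)))
  · calc _ ≤ ∫⁻ t in Ioi (1 : ℝ), ENNReal.ofReal ((4 * Real.pi) ^ (-((d : ℝ) / 2)) *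
            t ^ (α / 2 - 1 + -((d : ℝ) / 2))) * ∫⁻ x, g x := by
          refine setLIntegral_mono' measurableSet_Ioi fun t ht ↦ ?_
          have ht0 : (0 : ℝ) < t := one_pos.trans ht
          rw [← lintegral_const_mul' _ _ ENNReal.ofReal_ne_top]
          refine lintegral_mono fun x ↦ ?_
          gcongr ENNReal.ofReal ?_ * _
          calc t ^ (α / 2 - 1) * heatKernel d t (x - y) ≤
                t ^ (α / 2 - 1) * (4 * Real.pi * t) ^ (-((d : ℝ) / 2)) := by
                gcongr; exact heatKernel_le ht0 _
            _ = _ := by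
                rw [Real.mul_rpow (by positivity) ht0.le, Real.rpow_add ht0]; ring
      _ = (∫⁻ t in Ioi (1 : ℝ), ENNReal.ofReal ((4 * Real.pi) ^ (-((d : ℝ) / 2)) *
            t ^ (α / 2 - 1 + -((d : ℝ) / 2)))) * ∫⁻ x, g x :=
          lintegral_mul_const _ (by fun_prop)
      _ ≤ _ := by
          gcongr
          exact h2.trans (ENNReal.ofReal_le_ofReal ((le_max_right _ _).trans (le_max_left _ _)))

/-! ### Fubini for the Riesz potential of a finite measure -/

/-- The (unnormalized) Riesz potential of a positive measure. -/
def rieszMeasure (α : ℝ) (m : Measure (EuclideanSpace ℝ (Fin d)))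
    (x : EuclideanSpace ℝ (Fin d)) : ℝ :=
  ∫ t in Ioi (0 : ℝ), t ^ (α / 2 - 1) * ∫ y, heatKernel d t (x - y) ∂m

/-- The (unnormalized) Riesz potential of a function. -/
def rieszFun (α : ℝ) (g : EuclideanSpace ℝ (Fin d) → ℂ) (y : EuclideanSpace ℝ (Fin d)) : ℂ :=
  ∫ t in Ioi (0 : ℝ), ∫ x, g x * ((t ^ (α / 2 - 1) * heatKernel d t (x - y) : ℝ) : ℂ)

/-- Tonelli with y outermost: the inner bound is uniform in y, so a finite m only contributes its
mass. All later exchanges of x, t and y rest on this. -/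
theorem lintegral_enorm_riesz_le {α K : ℝ}
    (hK : ∀ (g : EuclideanSpace ℝ (Fin d) → ℝ≥0∞) (S : ℝ≥0∞), (∀ x, g x ≤ S) →
      ∀ y, ∫⁻ t in Ioi (0 : ℝ), ∫⁻ x,
          ENNReal.ofReal (t ^ (α / 2 - 1) * heatKernel d t (x - y)) * g x ≤
        ENNReal.ofReal K * (S + ∫⁻ x, g x))
    (m : Measure (EuclideanSpace ℝ (Fin d))) [IsFiniteMeasure m]
    {g : EuclideanSpace ℝ (Fin d) → ℂ} (hg : Measurable g) {S : ℝ≥0∞} (hS : ∀ x, ‖g x‖ₑ ≤ S) :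
    ∫⁻ z, ‖g z.1 * ((z.2.1 ^ (α / 2 - 1) * heatKernel d z.2.1 (z.1 - z.2.2) : ℝ) : ℂ)‖ₑ
        ∂((volume : Measure (EuclideanSpace ℝ (Fin d))).prod
          ((volume.restrict (Ioi (0 : ℝ))).prod m)) ≤
      ENNReal.ofReal K * (S + ∫⁻ x, ‖g x‖ₑ) * m univ := by
  have hm : Measurable fun z : EuclideanSpace ℝ (Fin d) × (ℝ × EuclideanSpace ℝ (Fin d)) ↦
      g z.1 * ((z.2.1 ^ (α / 2 - 1) * heatKernel d z.2.1 (z.1 - z.2.2) : ℝ) : ℂ) := by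
    have : Measurable fun z : EuclideanSpace ℝ (Fin d) × (ℝ × EuclideanSpace ℝ (Fin d)) ↦
      heatKernel d z.2.1 (z.1 - z.2.2) := measurable_heatKernel.comp
        (measurable_snd.fst.prodMk (measurable_fst.sub measurable_snd.snd))
    fun_prop
  rw [lintegral_prod_symm _ hm.enorm.aemeasurable,
    lintegral_prod_symm _ hm.enorm.lintegral_prod_left'.aemeasurable]
  calc _ ≤ ∫⁻ _, ENNReal.ofReal K * (S + ∫⁻ x, ‖g x‖ₑ) ∂m := by
        refine lintegral_mono fun y ↦ (le_of_eq ?_).trans (hK (fun x ↦ ‖g x‖ₑ) S hS y)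
        refine setLIntegral_congr_fun measurableSet_Ioi fun t ht ↦ ?_
        refine lintegral_congr fun x ↦ ?_
        have ht' : (0 : ℝ) < t := ht
        have := heatKernel_nonneg ht' (x - y)
        rw [enorm_mul, mul_comm, ← ofReal_norm, Complex.norm_real, Real.norm_of_nonneg]
        positivity
    _ = _ := lintegral_const _

theorem integrable_riesz {α : ℝ} (hα : 0 < α) (hαd : α < d)
    (m : Measure (EuclideanSpace ℝ (Fin d))) [IsFiniteMeasure m]
    {g : EuclideanSpace ℝ (Fin d) → ℂ} (hg : Measurable g) (hgi : Integrable g) {S : ℝ}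
    (hS : ∀ x, ‖g x‖ ≤ S) :
    Integrable (fun z : EuclideanSpace ℝ (Fin d) × (ℝ × EuclideanSpace ℝ (Fin d)) ↦
      g z.1 * ((z.2.1 ^ (α / 2 - 1) * heatKernel d z.2.1 (z.1 - z.2.2) : ℝ) : ℂ))
      ((volume : Measure (EuclideanSpace ℝ (Fin d))).prod
          ((volume.restrict (Ioi (0 : ℝ))).prod m)) := by
  obtain ⟨K, hK0, hK⟩ := exists_lintegral_rpow_mul_heat_le hα hαd
  have hm : Measurable fun z : EuclideanSpace ℝ (Fin d) × (ℝ × EuclideanSpace ℝ (Fin d)) ↦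
      g z.1 * ((z.2.1 ^ (α / 2 - 1) * heatKernel d z.2.1 (z.1 - z.2.2) : ℝ) : ℂ) := by
    have : Measurable fun z : EuclideanSpace ℝ (Fin d) × (ℝ × EuclideanSpace ℝ (Fin d)) ↦
      heatKernel d z.2.1 (z.1 - z.2.2) := measurable_heatKernel.comp
        (measurable_snd.fst.prodMk (measurable_fst.sub measurable_snd.snd))
    fun_prop
  refine ⟨hm.aestronglyMeasurable, ?_⟩
  refine (lintegral_enorm_riesz_le hK m hg (S := ENNReal.ofReal S) fun x ↦ ?_).trans_lt ?_
  · rw [← ofReal_norm]; exact ENNReal.ofReal_le_ofReal (hS x)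
  · exact ENNReal.mul_lt_top (ENNReal.mul_lt_top ENNReal.ofReal_lt_top
      (ENNReal.add_lt_top.2 ⟨ENNReal.ofReal_lt_top, hgi.2⟩)) (measure_lt_top _ _)

/-- Test the integrability on the triple product with a strictly positive g, here the heat kernel at
time 1. Almost every section in x is integrable, and the factor g x can be divided out. -/
theorem ae_integrable_riesz {α : ℝ} (hα : 0 < α) (hαd : α < d)
    (m : Measure (EuclideanSpace ℝ (Fin d))) [IsFiniteMeasure m] :
    ∀ᵐ x, Integrable (fun z : ℝ × EuclideanSpace ℝ (Fin d) ↦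
      z.1 ^ (α / 2 - 1) * heatKernel d z.1 (x - z.2)) ((volume.restrict (Ioi (0 : ℝ))).prod m) := by
  have h := integrable_riesz (g := fun x ↦ (heatKernel d 1 x : ℂ)) hα hαd m
    (Complex.measurable_ofReal.comp (continuous_heatKernel 1).measurable)
    (integrable_heatKernel one_pos).ofReal
    (S := (4 * Real.pi * 1) ^ (-((d : ℝ) / 2))) fun x ↦ by
      rw [Complex.norm_real, Real.norm_of_nonneg (heatKernel_nonneg one_pos x)]
      exact heatKernel_le one_pos x
  filter_upwards [h.prod_right_ae] with x hx
  have hpos : 0 < heatKernel d 1 x := by unfold heatKernel; positivity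
  have := (hx.const_mul ((heatKernel d 1 x : ℂ)⁻¹)).re
  refine this.congr (.of_forall fun z ↦ ?_)
  simp only
  rw [inv_mul_cancel_left₀ (by exact_mod_cast hpos.ne')]
  rfl

theorem ae_integrableOn_riesz {α : ℝ} (hα : 0 < α) (hαd : α < d)
    (m : Measure (EuclideanSpace ℝ (Fin d))) [IsFiniteMeasure m] :
    ∀ᵐ x, IntegrableOn (fun t : ℝ ↦ t ^ (α / 2 - 1) * ∫ y, heatKernel d t (x - y) ∂m) (Ioi 0) := by
  filter_upwards [ae_integrable_riesz hα hαd m] with x hx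
  simpa only [integral_const_mul, IntegrableOn] using hx.integral_prod_left

theorem heat_eq_pairing (μ : SignedMeasure (EuclideanSpace ℝ (Fin d))) {t : ℝ} (ht : 0 < t)
    (x : EuclideanSpace ℝ (Fin d)) :
    heat μ t x = pairing μ fun y ↦ heatKernel d t (x - y) := by
  refine integral_eq_pairing μ (Integrable.of_bound (C := (4 * Real.pi * t) ^ (-((d : ℝ) / 2)))
    ((continuous_heatKernel t).comp (by fun_prop)).aestronglyMeasurable (.of_forall fun y ↦ ?_))
  rw [Real.norm_of_nonneg (heatKernel_nonneg ht _)]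
  exact heatKernel_le ht _

theorem rieszIntegrand_eq (α : ℝ) (μ : SignedMeasure (EuclideanSpace ℝ (Fin d)))
    (x : EuclideanSpace ℝ (Fin d)) {t : ℝ} (ht : 0 < t) :
    rieszIntegrand α μ x t =
      t ^ (α / 2 - 1) * ∫ y, heatKernel d t (x - y) ∂μ.toJordanDecomposition.posPart -
      t ^ (α / 2 - 1) * ∫ y, heatKernel d t (x - y) ∂μ.toJordanDecomposition.negPart := by
  rw [rieszIntegrand, heat_eq_pairing μ ht, pairing, mul_sub]

theorem ae_integrableOn_rieszIntegrand {α : ℝ} (hα : 0 < α) (hαd : α < d)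
    (μ : SignedMeasure (EuclideanSpace ℝ (Fin d))) :
    ∀ᵐ x, IntegrableOn (rieszIntegrand α μ x) (Ioi 0) := by
  filter_upwards [ae_integrableOn_riesz hα hαd μ.toJordanDecomposition.posPart,
    ae_integrableOn_riesz hα hαd μ.toJordanDecomposition.negPart] with x h1 h2
  exact (Integrable.sub h1 h2).congr (by
    filter_upwards [ae_restrict_mem measurableSet_Ioi] with t ht
    exact (rieszIntegrand_eq α μ x ht).symm)

theorem ae_rieszPotential_eq {α : ℝ} (hα : 0 < α) (hαd : α < d)
    (μ : SignedMeasure (EuclideanSpace ℝ (Fin d))) :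
    ∀ᵐ x, rieszPotential α μ x = 1 / Real.Gamma (α / 2) *
      (rieszMeasure α μ.toJordanDecomposition.posPart x -
        rieszMeasure α μ.toJordanDecomposition.negPart x) := by
  filter_upwards [ae_integrableOn_riesz hα hαd μ.toJordanDecomposition.posPart,
    ae_integrableOn_riesz hα hαd μ.toJordanDecomposition.negPart] with x h1 h2
  rw [rieszPotential, rieszMeasure, rieszMeasure, ← integral_sub h1 h2]
  congr 1
  exact setIntegral_congr_fun measurableSet_Ioi fun t ht ↦ rieszIntegrand_eq α μ x ht

theorem ae_mul_rieszMeasure_eq {α : ℝ} (hα : 0 < α) (hαd : α < d)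
    (m : Measure (EuclideanSpace ℝ (Fin d))) [IsFiniteMeasure m] (g : EuclideanSpace ℝ (Fin d) → ℂ) :
    ∀ᵐ x, ∫ z : ℝ × EuclideanSpace ℝ (Fin d),
        g x * ((z.1 ^ (α / 2 - 1) * heatKernel d z.1 (x - z.2) : ℝ) : ℂ)
        ∂((volume.restrict (Ioi (0 : ℝ))).prod m) = g x * (rieszMeasure α m x : ℂ) := by
  filter_upwards [ae_integrable_riesz hα hαd m] with x hx
  rw [integral_const_mul, integral_complex_ofReal, integral_prod _ hx]
  simp_rw [integral_const_mul]
  rfl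

theorem integrable_mul_rieszMeasure {α : ℝ} (hα : 0 < α) (hαd : α < d)
    (m : Measure (EuclideanSpace ℝ (Fin d))) [IsFiniteMeasure m]
    {g : EuclideanSpace ℝ (Fin d) → ℂ} (hg : Measurable g) (hgi : Integrable g) {S : ℝ}
    (hS : ∀ x, ‖g x‖ ≤ S) :
    Integrable fun x ↦ g x * (rieszMeasure α m x : ℂ) :=
  (integrable_riesz hα hαd m hg hgi hS).integral_prod_left.congr
    (ae_mul_rieszMeasure_eq hα hαd m g)

theorem integral_mul_rieszMeasure {α : ℝ} (hα : 0 < α) (hαd : α < d)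
    (m : Measure (EuclideanSpace ℝ (Fin d))) [IsFiniteMeasure m]
    {g : EuclideanSpace ℝ (Fin d) → ℂ} (hg : Measurable g) (hgi : Integrable g) {S : ℝ}
    (hS : ∀ x, ‖g x‖ ≤ S) :
    ∫ x, g x * (rieszMeasure α m x : ℂ) = ∫ y, rieszFun α g y ∂m := by
  have hi := integrable_riesz hα hαd m hg hgi hS
  rw [← integral_congr_ae (ae_mul_rieszMeasure_eq hα hαd m g),
    integral_integral_swap hi, integral_prod_symm _ hi.integral_prod_right]
  rfl

/-- Sup norm and L¹ norm are both controlled by Schwartz seminorms, so this bound gives continuity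
on the Schwartz space. -/
theorem exists_norm_integral_mul_rieszMeasure_le {α : ℝ} (hα : 0 < α) (hαd : α < d)
    (m : Measure (EuclideanSpace ℝ (Fin d))) [IsFiniteMeasure m] :
    ∃ K : ℝ, 0 ≤ K ∧ ∀ (g : EuclideanSpace ℝ (Fin d) → ℂ) (S : ℝ), 0 ≤ S → Measurable g →
      Integrable g → (∀ x, ‖g x‖ ≤ S) →
      ‖∫ x, g x * (rieszMeasure α m x : ℂ)‖ ≤ K * (S + ∫ x, ‖g x‖) := by
  obtain ⟨K, hK0, hK⟩ := exists_lintegral_rpow_mul_heat_le hα hαd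
  refine ⟨K * m.real univ, by positivity, fun g S hS0 hg hgi hS ↦ ?_⟩
  have hi := integrable_riesz hα hαd m hg hgi hS
  rw [← integral_congr_ae (ae_mul_rieszMeasure_eq hα hαd m g), ← integral_prod _ hi]
  refine (norm_integral_le_lintegral_norm _).trans ?_
  refine ENNReal.toReal_le_of_le_ofReal (by positivity) ?_
  simp_rw [ofReal_norm]
  refine (lintegral_enorm_riesz_le hK m hg (S := ENNReal.ofReal S) fun x ↦ ?_).trans_eq ?_
  · rw [← ofReal_norm]; exact ENNReal.ofReal_le_ofReal (hS x)
  · rw [mul_right_comm, ENNReal.ofReal_mul (by positivity), ENNReal.ofReal_mul hK0,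
      ENNReal.ofReal_add hS0 (by positivity), ofReal_integral_norm_eq_lintegral_enorm hgi,
      ofReal_measureReal]

/-- The Riesz potential of a finite signed measure is a tempered distribution. -/
theorem exists_isGivenBy_rieszPotential {α : ℝ} (hα : 0 < α) (hαd : α < d)
    (μ : SignedMeasure (EuclideanSpace ℝ (Fin d))) :
    ∃ T : 𝓢'(EuclideanSpace ℝ (Fin d), ℂ), IsGivenBy T (rieszPotential α μ) ∧
      ∀ g : 𝓢(EuclideanSpace ℝ (Fin d), ℂ),
        T g = pairing μ fun y ↦ ((1 / Real.Gamma (α / 2) : ℝ) : ℂ) * rieszFun α g y := by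
  have hbd : ∀ (g : 𝓢(EuclideanSpace ℝ (Fin d), ℂ)) x, ‖g x‖ ≤ SchwartzMap.seminorm ℂ 0 0 g :=
    fun g ↦ SchwartzMap.norm_le_seminorm ℂ g
  have hae := ae_rieszPotential_eq hα hαd μ
  have hint : ∀ (m : Measure (EuclideanSpace ℝ (Fin d))) [IsFiniteMeasure m]
      (g : 𝓢(EuclideanSpace ℝ (Fin d), ℂ)), Integrable fun x ↦ g x * (rieszMeasure α m x : ℂ) :=
    fun m _ g ↦ integrable_mul_rieszMeasure hα hαd m g.continuous.measurable g.integrable (hbd g)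
  have hcongr : ∀ g : 𝓢(EuclideanSpace ℝ (Fin d), ℂ),
      (fun x ↦ g x * (rieszPotential α μ x : ℂ)) =ᵐ[volume] fun x ↦
        ((1 / Real.Gamma (α / 2) : ℝ) : ℂ) *
        (g x * (rieszMeasure α μ.toJordanDecomposition.posPart x : ℂ) -
          g x * (rieszMeasure α μ.toJordanDecomposition.negPart x : ℂ)) := fun g ↦ by
    filter_upwards [hae] with x hx
    rw [hx]
    push_cast
    ring
  have hI : ∀ g : 𝓢(EuclideanSpace ℝ (Fin d), ℂ),
      Integrable fun x ↦ g x * (rieszPotential α μ x : ℂ) := fun g ↦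
    (((hint _ g).sub (hint _ g)).const_mul _).congr (hcongr g).symm
  have hE : ∀ g : 𝓢(EuclideanSpace ℝ (Fin d), ℂ), ∫ x, g x * (rieszPotential α μ x : ℂ) =
      ((1 / Real.Gamma (α / 2) : ℝ) : ℂ) *
        ((∫ x, g x * (rieszMeasure α μ.toJordanDecomposition.posPart x : ℂ)) -
          ∫ x, g x * (rieszMeasure α μ.toJordanDecomposition.negPart x : ℂ)) := fun g ↦ by
    rw [integral_congr_ae (hcongr g), integral_const_mul, integral_sub (hint _ g) (hint _ g)]
  obtain ⟨K1, hK1, h1⟩ := exists_norm_integral_mul_rieszMeasure_le hα hαd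
    μ.toJordanDecomposition.posPart
  obtain ⟨K2, hK2, h2⟩ := exists_norm_integral_mul_rieszMeasure_le hα hαd
    μ.toJordanDecomposition.negPart
  obtain ⟨k, C, hC, hL⟩ := SchwartzMap.norm_toLp_le_seminorm ℂ ℂ
    (E := EuclideanSpace ℝ (Fin d)) 1 volume
  let L : 𝓢(EuclideanSpace ℝ (Fin d), ℂ) →L[ℂ] ℂ := SchwartzMap.mkCLMtoNormedSpace
    (fun g ↦ ∫ x, g x * (rieszPotential α μ x : ℂ))
    (fun f g ↦ by
      rw [← integral_add (hI f) (hI g)]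
      simp [add_mul])
    (fun a g ↦ by
      simp only [_root_.smul_apply, smul_eq_mul, mul_assoc, integral_const_mul,
        RingHom.id_apply])
    ⟨Finset.Iic (k, 0), |1 / Real.Gamma (α / 2)| * ((K1 + K2) * (1 + C)), by positivity, fun g ↦ by
      have hN : ∫ x, ‖g x‖ ≤ C * (Finset.Iic (k, 0)).sup
          (schwartzSeminormFamily ℂ (EuclideanSpace ℝ (Fin d)) ℂ) g := by
        rw [← SchwartzMap.norm_toLp_one]; exact hL g
      have hS : SchwartzMap.seminorm ℂ 0 0 g ≤ (Finset.Iic (k, 0)).sup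
          (schwartzSeminormFamily ℂ (EuclideanSpace ℝ (Fin d)) ℂ) g :=
        Seminorm.le_def.1 (Finset.le_sup (f := schwartzSeminormFamily ℂ _ ℂ)
          (b := ((0, 0) : ℕ × ℕ)) (by simp)) g
      set q := (Finset.Iic (k, 0)).sup
          (schwartzSeminormFamily ℂ (EuclideanSpace ℝ (Fin d)) ℂ) g
      have b1 := h1 g _ (apply_nonneg _ _) g.continuous.measurable g.integrable (hbd g)
      have b2 := h2 g _ (apply_nonneg _ _) g.continuous.measurable g.integrable (hbd g)
      rw [hE g, norm_mul, Complex.norm_real, Real.norm_eq_abs, mul_assoc]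
      refine mul_le_mul_of_nonneg_left ((norm_sub_le _ _).trans ?_) (abs_nonneg _)
      have h3 : SchwartzMap.seminorm ℂ 0 0 g + ∫ x, ‖g x‖ ≤ (1 + C) * q := by linarith
      calc _ ≤ (K1 + K2) * (SchwartzMap.seminorm ℂ 0 0 g + ∫ x, ‖g x‖) := by linarith
        _ ≤ (K1 + K2) * ((1 + C) * q) := by gcongr
        _ = _ := by ring⟩
  refine ⟨ContinuousLinearMap.toPointwiseConvergenceCLM _ _ _ _ L, fun g ↦ ⟨hI g, rfl⟩, fun g ↦ ?_⟩
  change ∫ x, g x * (rieszPotential α μ x : ℂ) = _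
  rw [hE g, integral_mul_rieszMeasure hα hαd _ g.continuous.measurable g.integrable (hbd g),
    integral_mul_rieszMeasure hα hαd _ g.continuous.measurable g.integrable (hbd g), pairing,
    integral_const_mul, integral_const_mul, mul_sub]

/-! ### Fourier representation of the heat semigroup -/

/-- The function w ↦ heatKernel d t (v - w) is the Fourier transform of a modulated Gaussian G, and
∫ φ 𝓕G = ∫ 𝓕φ G. -/
theorem integral_mul_heatKernel_eq (φ : 𝓢(EuclideanSpace ℝ (Fin d), ℂ)) {t : ℝ} (ht : 0 < t)
    (v : EuclideanSpace ℝ (Fin d)) :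
    ∫ w, φ w * (heatKernel d t (v - w) : ℂ) =
      ∫ ξ, (𝓕 φ : 𝓢(EuclideanSpace ℝ (Fin d), ℂ)) ξ *
        (Complex.exp (((2 * Real.pi * inner ℝ ξ v : ℝ) : ℂ) * Complex.I) *
          (Real.exp (-(4 * Real.pi ^ 2 * ‖ξ‖ ^ 2 * t)) : ℂ)) := by
  set b : ℂ := ((4 * Real.pi ^ 2 * t : ℝ) : ℂ) with hb
  have hbre : 0 < b.re := by rw [hb, Complex.ofReal_re]; positivity
  set G : EuclideanSpace ℝ (Fin d) → ℂ := fun ξ ↦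
    Complex.exp (-b * ‖ξ‖ ^ 2 + 2 * Real.pi * Complex.I * inner ℝ v ξ) with hG
  have hGi : Integrable G := GaussianFourier.integrable_cexp_neg_mul_sq_norm_add hbre _ v
  have hFG : ∀ w, 𝓕 G w = (heatKernel d t (v - w) : ℂ) := fun w ↦ by
    rw [hG, fourier_gaussian_innerProductSpace' hbre v w, heatKernel, finrank_euclideanSpace_fin,
      Complex.ofReal_mul, Complex.ofReal_cpow (by positivity), Complex.ofReal_exp]
    have hpi : (Real.pi : ℂ) ≠ 0 := by exact_mod_cast Real.pi_ne_zero
    have ht0 : (t : ℂ) ≠ 0 := by exact_mod_cast ht.ne'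
    congr 1
    · rw [show (Real.pi / b : ℂ) = ((4 * Real.pi * t : ℝ) : ℂ)⁻¹ by
          rw [hb]; push_cast; field_simp,
        Complex.inv_cpow _ _ (by
          rw [Complex.arg_ofReal_of_nonneg (by positivity)]; exact Real.pi_pos.ne),
        ← Complex.cpow_neg]
      push_cast
      rfl
    · congr 1
      rw [hb]
      push_cast
      field_simp
  have h := VectorFourier.integral_bilin_fourierIntegral_eq_flip (ContinuousLinearMap.mul ℂ ℂ)
    (μ := volume) (ν := volume) (L := innerₗ (EuclideanSpace ℝ (Fin d)))
    Real.continuous_fourierChar continuous_inner φ.integrable hGi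
  rw [flip_innerₗ] at h
  simp_rw [← hFG]
  refine h.symm.trans (integral_congr_ae (.of_forall fun ξ ↦ ?_))
  change (𝓕 φ : 𝓢(EuclideanSpace ℝ (Fin d), ℂ)) ξ * G ξ = _
  rw [hG]
  simp only
  rw [Complex.ofReal_exp, ← Complex.exp_add, hb, real_inner_comm]
  congr 2
  push_cast
  ring

theorem apply_eq_integral_fourier (φ : 𝓢(EuclideanSpace ℝ (Fin d), ℂ))
    (v : EuclideanSpace ℝ (Fin d)) :
    φ v = ∫ ξ, (𝓕 φ : 𝓢(EuclideanSpace ℝ (Fin d), ℂ)) ξ *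
      Complex.exp (((2 * Real.pi * inner ℝ ξ v : ℝ) : ℂ) * Complex.I) := by
  have h : (𝓕⁻ (𝓕 φ : 𝓢(EuclideanSpace ℝ (Fin d), ℂ)) : 𝓢(EuclideanSpace ℝ (Fin d), ℂ)) = φ :=
    FourierTransform.fourierInv_fourier_eq φ
  conv_lhs => rw [← h, SchwartzMap.fourierInv_coe, Real.fourierInv_eq']
  simp_rw [smul_eq_mul, mul_comm]

/-- Fourier multipliers that are smooth away from the origin act on Schwartz functions whose
Fourier transform is supported in an annulus. -/
theorem exists_fourier_eq_mul (φ : 𝓢(EuclideanSpace ℝ (Fin d), ℂ))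
    (hc : HasCompactSupport (𝓕 φ : 𝓢(EuclideanSpace ℝ (Fin d), ℂ)))
    (h0 : ∀ᶠ ξ in 𝓝 0, (𝓕 φ : 𝓢(EuclideanSpace ℝ (Fin d), ℂ)) ξ = 0)
    {m : EuclideanSpace ℝ (Fin d) → ℂ} (hm : ∀ ξ, ξ ≠ 0 → ContDiffAt ℝ (⊤ : ℕ∞) m ξ) :
    ∃ Θ : 𝓢(EuclideanSpace ℝ (Fin d), ℂ),
      ∀ ξ, (𝓕 Θ : 𝓢(EuclideanSpace ℝ (Fin d), ℂ)) ξ =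
        m ξ * (𝓕 φ : 𝓢(EuclideanSpace ℝ (Fin d), ℂ)) ξ := by
  have hs : ContDiff ℝ (⊤ : ℕ∞)
      (fun ξ ↦ m ξ * (𝓕 φ : 𝓢(EuclideanSpace ℝ (Fin d), ℂ)) ξ) := by
    rw [contDiff_iff_contDiffAt]
    intro ξ
    -- The multiplier may be singular at 0, but there the product vanishes identically in a
    -- neighbourhood.
    rcases eq_or_ne ξ 0 with rfl | hξ
    · refine (contDiffAt_const (c := (0 : ℂ))).congr_of_eventuallyEq ?_
      filter_upwards [h0] with η hη
      rw [hη, mul_zero]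
    · exact (hm ξ hξ).mul (SchwartzMap.contDiffAt _ _)
  have hcs : HasCompactSupport (fun ξ ↦ m ξ * (𝓕 φ : 𝓢(EuclideanSpace ℝ (Fin d), ℂ)) ξ) :=
    hc.mul_left
  refine ⟨𝓕⁻ (hcs.toSchwartzMap hs), fun ξ ↦ ?_⟩
  rw [FourierTransform.fourier_fourierInv_eq]
  rfl

/-- On the Fourier side the time integral is a Gamma integral, equal to Γ(α/2) (4π²|ξ|²)^{-α/2}.
Exchanging t and ξ is legitimate because 𝓕 φ vanishes for |ξ| < r, so the Gaussian factor is at most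
exp(-4π²r²t). -/
theorem integral_rpow_mul_heat_eq {α : ℝ} (hα : 0 < α) (φ Ψ : 𝓢(EuclideanSpace ℝ (Fin d), ℂ))
    (h0 : ∀ᶠ ξ in 𝓝 0, (𝓕 φ : 𝓢(EuclideanSpace ℝ (Fin d), ℂ)) ξ = 0)
    (hΨ : ∀ ξ, (𝓕 Ψ : 𝓢(EuclideanSpace ℝ (Fin d), ℂ)) ξ =
      (((1 / (4 * Real.pi ^ 2 * ‖ξ‖ ^ 2)) ^ (α / 2) : ℝ) : ℂ) *
        (𝓕 φ : 𝓢(EuclideanSpace ℝ (Fin d), ℂ)) ξ) (v : EuclideanSpace ℝ (Fin d)) :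
    ∫ t in Ioi (0 : ℝ), ((t ^ (α / 2 - 1) : ℝ) : ℂ) * ∫ w, φ w * (heatKernel d t (v - w) : ℂ) =
      (Real.Gamma (α / 2) : ℂ) * Ψ v := by
  obtain ⟨r, hr, hr0⟩ := Metric.eventually_nhds_iff.1 h0
  set φ' : 𝓢(EuclideanSpace ℝ (Fin d), ℂ) := 𝓕 φ
  set E : EuclideanSpace ℝ (Fin d) → ℂ := fun ξ ↦
    Complex.exp (((2 * Real.pi * inner ℝ ξ v : ℝ) : ℂ) * Complex.I) with hE
  have hE1 : ∀ ξ, ‖E ξ‖ = 1 := fun ξ ↦ Complex.norm_exp_ofReal_mul_I _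
  have hEm : Measurable E := by rw [hE]; fun_prop
  have hr' : ∀ ξ, φ' ξ ≠ 0 → r ≤ ‖ξ‖ := fun ξ hξ ↦ by
    by_contra! h
    exact hξ (hr0 (by simpa using h))
  have hi1 : IntegrableOn (fun t : ℝ ↦ t ^ (α / 2 - 1) * Real.exp (-(4 * Real.pi ^ 2 * r ^ 2 * t)))
      (Ioi 0) := by
    have hpos : 0 < (1 / (4 * Real.pi ^ 2 * r ^ 2)) ^ (α / 2) * Real.Gamma (α / 2) := by
      have := Real.Gamma_pos_of_pos (half_pos hα)
      positivity
    rw [← Real.integral_rpow_mul_exp_neg_mul_Ioi (half_pos hα) (by positivity)] at hpos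
    -- The Bochner integral of a non-integrable function is 0 by convention, so the positive Gamma
    -- value forces integrability.
    exact Integrable.of_integral_ne_zero hpos.ne'
  have hint : Integrable (fun z : ℝ × EuclideanSpace ℝ (Fin d) ↦ ((z.1 ^ (α / 2 - 1) : ℝ) : ℂ) *
      (φ' z.2 * (E z.2 * (Real.exp (-(4 * Real.pi ^ 2 * ‖z.2‖ ^ 2 * z.1)) : ℂ))))
      ((volume.restrict (Ioi (0 : ℝ))).prod volume) := by
    refine (Integrable.mul_prod hi1 φ'.integrable.norm).mono' ?_ ?_
    · have : Measurable φ' := φ'.continuous.measurable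
      exact Measurable.aestronglyMeasurable (by fun_prop)
    · have : ∀ᵐ z : ℝ × EuclideanSpace ℝ (Fin d)
          ∂((volume.restrict (Ioi (0 : ℝ))).prod volume), z.1 ∈ Ioi (0 : ℝ) :=
        Measure.quasiMeasurePreserving_fst.ae (ae_restrict_mem measurableSet_Ioi)
      filter_upwards [this] with z hz
      have hz' : (0 : ℝ) < z.1 := hz
      rw [norm_mul, norm_mul, norm_mul, hE1, one_mul, Complex.norm_real, Complex.norm_real,
        Real.norm_of_nonneg (Real.rpow_nonneg hz'.le _), Real.norm_of_nonneg (Real.exp_pos _).le]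
      rcases eq_or_ne (φ' z.2) 0 with h | h
      · simp [h]
      · rw [mul_comm ‖φ' z.2‖, ← mul_assoc]
        have := hr' _ h
        gcongr
  calc _ = ∫ t in Ioi (0 : ℝ), ∫ ξ, ((t ^ (α / 2 - 1) : ℝ) : ℂ) *
        (φ' ξ * (E ξ * (Real.exp (-(4 * Real.pi ^ 2 * ‖ξ‖ ^ 2 * t)) : ℂ))) := by
        refine setIntegral_congr_fun measurableSet_Ioi fun t ht ↦ ?_
        rw [integral_mul_heatKernel_eq φ ht v, integral_const_mul]
    _ = ∫ ξ, ∫ t in Ioi (0 : ℝ), ((t ^ (α / 2 - 1) : ℝ) : ℂ) *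
        (φ' ξ * (E ξ * (Real.exp (-(4 * Real.pi ^ 2 * ‖ξ‖ ^ 2 * t)) : ℂ))) :=
        integral_integral_swap hint
    _ = ∫ ξ, (Real.Gamma (α / 2) : ℂ) *
        ((𝓕 Ψ : 𝓢(EuclideanSpace ℝ (Fin d), ℂ)) ξ * E ξ) := by
        refine integral_congr_ae (.of_forall fun ξ ↦ ?_)
        simp only
        rw [hΨ]
        rcases eq_or_ne (φ' ξ) 0 with h | h
        · simp [h]
        · have hξ : 0 < ‖ξ‖ := hr.trans_le (hr' ξ h)
          have hG := Real.integral_rpow_mul_exp_neg_mul_Ioi (half_pos hα)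
            (r := 4 * Real.pi ^ 2 * ‖ξ‖ ^ 2) (by positivity)
          calc _ = ∫ t in Ioi (0 : ℝ), (φ' ξ * E ξ) *
                ((t ^ (α / 2 - 1) * Real.exp (-(4 * Real.pi ^ 2 * ‖ξ‖ ^ 2 * t)) : ℝ) : ℂ) := by
                congr 1 with t
                push_cast
                ring
            _ = _ := by
                rw [integral_const_mul, integral_complex_ofReal, hG]
                push_cast
                ring
    _ = _ := by
        rw [integral_const_mul, ← apply_eq_integral_fourier Ψ v]

/-! ### The Littlewood-Paley piece of the Riesz kernel -/

/-- The Schwartz function `Ξ - 2^{-d} Ξ(·/2)`. -/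
def lpDiff (Ξ : 𝓢(EuclideanSpace ℝ (Fin d), ℂ)) : 𝓢(EuclideanSpace ℝ (Fin d), ℂ) :=
  Ξ - ((2 : ℂ) ^ d)⁻¹ • Ξ.compCLMOfContinuousLinearEquiv ℂ
    (ContinuousLinearEquiv.smulLeft (Units.mk0 (2⁻¹ : ℝ) (by norm_num)))

theorem lpDiff_apply (Ξ : 𝓢(EuclideanSpace ℝ (Fin d), ℂ)) (x : EuclideanSpace ℝ (Fin d)) :
    lpDiff Ξ x = Ξ x - ((2 : ℂ) ^ d)⁻¹ * Ξ ((2⁻¹ : ℝ) • x) := rfl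

theorem fourier_lpDiff (Ξ : 𝓢(EuclideanSpace ℝ (Fin d), ℂ)) (ξ : EuclideanSpace ℝ (Fin d)) :
    (𝓕 (lpDiff Ξ) : 𝓢(EuclideanSpace ℝ (Fin d), ℂ)) ξ =
      (𝓕 Ξ : 𝓢(EuclideanSpace ℝ (Fin d), ℂ)) ξ -
        (𝓕 Ξ : 𝓢(EuclideanSpace ℝ (Fin d), ℂ)) ((2 : ℝ) • ξ) := by
  set D := Ξ.compCLMOfContinuousLinearEquiv ℂ
    (ContinuousLinearEquiv.smulLeft (Units.mk0 (2⁻¹ : ℝ) (by norm_num))) with hD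
  have h1 : (𝓕 (lpDiff Ξ) : 𝓢(EuclideanSpace ℝ (Fin d), ℂ)) =
      𝓕 Ξ - ((2 : ℂ) ^ d)⁻¹ • 𝓕 D := by
    change SchwartzMap.fourierTransformCLM ℂ (Ξ - ((2 : ℂ) ^ d)⁻¹ • D) = _
    rw [map_sub, map_smul]
    rfl
  rw [h1]
  change (𝓕 Ξ : 𝓢(EuclideanSpace ℝ (Fin d), ℂ)) ξ -
    ((2 : ℂ) ^ d)⁻¹ * (𝓕 D : 𝓢(EuclideanSpace ℝ (Fin d), ℂ)) ξ = _
  congr 1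
  rw [SchwartzMap.fourier_coe, SchwartzMap.fourier_coe, Real.fourier_eq', Real.fourier_eq']
  have h2 := Measure.integral_comp_inv_smul_of_nonneg volume
    (fun x ↦ Complex.exp (((-2 * Real.pi * inner ℝ x ((2 : ℝ) • ξ) : ℝ) : ℂ) * Complex.I) • Ξ x)
    (R := 2) zero_le_two
  rw [finrank_euclideanSpace_fin] at h2
  have h3 : ∀ x : EuclideanSpace ℝ (Fin d), inner ℝ ((2⁻¹ : ℝ) • x) ((2 : ℝ) • ξ) = inner ℝ x ξ :=
    fun x ↦ by rw [real_inner_smul_left, real_inner_smul_right]; ring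
  simp_rw [h3] at h2
  change ((2 : ℂ) ^ d)⁻¹ * ∫ x, Complex.exp (((-2 * Real.pi * inner ℝ x ξ : ℝ) : ℂ) * Complex.I) •
    Ξ ((2⁻¹ : ℝ) • x) = _
  rw [h2, Complex.real_smul]
  push_cast
  rw [inv_mul_cancel_left₀ (pow_ne_zero _ two_ne_zero)]

/-- `Ψ = I_α (Ξ - 2^{-d} Ξ(·/2))` is a Schwartz function, and it is the heat extension of a
Schwartz function. -/
theorem exists_riesz_profile {α : ℝ} (hα : 0 < α) {Ξ : 𝓢(EuclideanSpace ℝ (Fin d), ℂ)}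
    (hΞ : IsLPGenerator Ξ) :
    ∃ Ψ Φ : 𝓢(EuclideanSpace ℝ (Fin d), ℂ),
      (∀ v, ∫ t in Ioi (0 : ℝ), ((t ^ (α / 2 - 1) : ℝ) : ℂ) *
          ∫ w, lpDiff Ξ w * (heatKernel d t (v - w) : ℂ) = (Real.Gamma (α / 2) : ℂ) * Ψ v) ∧
      ∀ v, Ψ v = ∫ w, Φ w * (heatKernel d 1 (v - w) : ℂ) := by
  have h0 : ∀ᶠ ξ in 𝓝 0, (𝓕 (lpDiff Ξ) : 𝓢(EuclideanSpace ℝ (Fin d), ℂ)) ξ = 0 := by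
    have h2 : Tendsto (fun ξ : EuclideanSpace ℝ (Fin d) ↦ (2 : ℝ) • ξ) (𝓝 0) (𝓝 0) := by
      have : Continuous fun ξ : EuclideanSpace ℝ (Fin d) ↦ (2 : ℝ) • ξ := by fun_prop
      simpa using this.tendsto 0
    filter_upwards [hΞ.2, h2.eventually hΞ.2] with ξ h1 h2
    rw [fourier_lpDiff, h1, h2, sub_self]
  have hc : HasCompactSupport (𝓕 (lpDiff Ξ) : 𝓢(EuclideanSpace ℝ (Fin d), ℂ)) := by
    have h1 := hΞ.1.sub (hΞ.1.comp_homeomorph (Homeomorph.smulOfNeZero (2 : ℝ) two_ne_zero))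
    exact (funext (fourier_lpDiff Ξ) : ⇑(𝓕 (lpDiff Ξ) : 𝓢(EuclideanSpace ℝ (Fin d), ℂ)) = _) ▸ h1
  have hm1 : ∀ ξ : EuclideanSpace ℝ (Fin d), ξ ≠ 0 → ContDiffAt ℝ (⊤ : ℕ∞)
      (fun ξ ↦ (((1 / (4 * Real.pi ^ 2 * ‖ξ‖ ^ 2)) ^ (α / 2) : ℝ) : ℂ)) ξ := fun ξ hξ ↦ by
    have hpos : 0 < ‖ξ‖ := norm_pos_iff.2 hξ
    refine Complex.ofRealCLM.contDiff.contDiffAt.comp ξ ?_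
    refine ContDiffAt.rpow_const_of_ne (contDiffAt_const.div
      (contDiffAt_const.mul (contDiff_norm_sq ℝ).contDiffAt) (by positivity)) (by positivity)
  -- The extra factor exp(4π²|ξ|²) inverts the heat flow at time 1; its growth is harmless on a
  -- compact frequency support.
  have hm2 : ∀ ξ : EuclideanSpace ℝ (Fin d), ξ ≠ 0 → ContDiffAt ℝ (⊤ : ℕ∞)
      (fun ξ ↦ ((Real.exp (4 * Real.pi ^ 2 * ‖ξ‖ ^ 2) : ℝ) : ℂ) *
        (((1 / (4 * Real.pi ^ 2 * ‖ξ‖ ^ 2)) ^ (α / 2) : ℝ) : ℂ)) ξ := fun ξ hξ ↦ by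
    refine ContDiffAt.mul (Complex.ofRealCLM.contDiff.contDiffAt.comp ξ ?_) (hm1 ξ hξ)
    exact (contDiff_const.mul (contDiff_norm_sq ℝ)).exp.contDiffAt
  obtain ⟨Ψ, hΨ⟩ := exists_fourier_eq_mul _ hc h0 hm1
  obtain ⟨Φ, hΦ⟩ := exists_fourier_eq_mul _ hc h0 hm2
  refine ⟨Ψ, Φ, integral_rpow_mul_heat_eq hα _ Ψ h0 hΨ, fun v ↦ ?_⟩
  rw [integral_mul_heatKernel_eq Φ one_pos, apply_eq_integral_fourier Ψ v]
  refine integral_congr_ae (.of_forall fun ξ ↦ ?_)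
  simp only
  rw [hΨ, hΦ, mul_one, Real.exp_neg, Complex.ofReal_inv]
  have : ((Real.exp (4 * Real.pi ^ 2 * ‖ξ‖ ^ 2) : ℝ) : ℂ) ≠ 0 := by
    exact_mod_cast (Real.exp_pos _).ne'
  field_simp

/-! ### Scaling -/

theorem heatKernel_smul {R : ℝ} (hR : 0 < R) {t : ℝ} (ht : 0 < t)
    (x : EuclideanSpace ℝ (Fin d)) :
    heatKernel d (R ^ 2 * t) (R • x) = (R ^ d)⁻¹ * heatKernel d t x := by
  have h1 : (4 * Real.pi * (R ^ 2 * t)) ^ (-((d : ℝ) / 2)) =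
      (R ^ d)⁻¹ * (4 * Real.pi * t) ^ (-((d : ℝ) / 2)) := by
    rw [show 4 * Real.pi * (R ^ 2 * t) = R ^ 2 * (4 * Real.pi * t) by ring,
      Real.mul_rpow (by positivity) (by positivity), ← Real.rpow_natCast R 2, ← Real.rpow_mul hR.le,
      ← Real.rpow_natCast R d, ← Real.rpow_neg hR.le]
    congr 2
    push_cast
    ring
  rw [heatKernel, heatKernel, h1, norm_smul, Real.norm_of_nonneg hR.le, mul_assoc]
  congr 3
  field_simp

theorem integral_comp_smul_sub {F : Type*} [NormedAddCommGroup F] [NormedSpace ℝ F]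
    (f : EuclideanSpace ℝ (Fin d) → F) {R : ℝ} (hR : 0 < R) (x : EuclideanSpace ℝ (Fin d)) :
    ∫ z, f (R • (x - z)) = (R ^ d)⁻¹ • ∫ w, f w := by
  rw [integral_sub_left_eq_self (fun z ↦ f (R • z)),
    Measure.integral_comp_smul_of_nonneg volume f R (hR := hR.le), finrank_euclideanSpace_fin]

/-- The dilated kernel `R^{d-α} Ψ(R z)`. -/
def dilatedKernel (α : ℝ) (Ψ : 𝓢(EuclideanSpace ℝ (Fin d), ℂ)) (R : ℝ)
    (z : EuclideanSpace ℝ (Fin d)) : ℂ :=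
  ((R ^ d * R ^ (-α) : ℝ) : ℂ) * Ψ (R • z)

/-- Parabolic scaling w = R(x - z), s = R²t. The time weight gives (R²)^{1-α/2} and ds gives R^{-2},
together R^{-α}. -/
theorem rieszFun_dilation {α : ℝ} {ψ Ψ : 𝓢(EuclideanSpace ℝ (Fin d), ℂ)}
    (hΨ : ∀ v, ∫ t in Ioi (0 : ℝ), ((t ^ (α / 2 - 1) : ℝ) : ℂ) *
          ∫ w, ψ w * (heatKernel d t (v - w) : ℂ) = (Real.Gamma (α / 2) : ℂ) * Ψ v)
    {R : ℝ} (hR : 0 < R) (x y : EuclideanSpace ℝ (Fin d)) :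
    rieszFun α (fun z ↦ ((R ^ d : ℝ) : ℂ) * ψ (R • (x - z))) y =
      (Real.Gamma (α / 2) : ℂ) * dilatedKernel α Ψ R (x - y) := by
  set v := R • (x - y) with hv
  have h1 : ∀ t : ℝ, 0 < t → ∫ z, ((R ^ d : ℝ) : ℂ) * ψ (R • (x - z)) *
      ((t ^ (α / 2 - 1) * heatKernel d t (z - y) : ℝ) : ℂ) =
      ((R ^ d * (R ^ 2) ^ (1 - α / 2) : ℝ) : ℂ) * ((((R ^ 2 * t) ^ (α / 2 - 1) : ℝ) : ℂ) *
        ∫ w, ψ w * (heatKernel d (R ^ 2 * t) (v - w) : ℂ)) := fun t ht ↦ by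
    have h2 : ∀ z, ((R ^ d : ℝ) : ℂ) * ψ (R • (x - z)) *
        ((t ^ (α / 2 - 1) * heatKernel d t (z - y) : ℝ) : ℂ) =
        ((R ^ d * R ^ d * t ^ (α / 2 - 1) : ℝ) : ℂ) * (fun w ↦ ψ w *
          (heatKernel d (R ^ 2 * t) (v - w) : ℂ)) (R • (x - z)) := fun z ↦ by
      have h3 : v - R • (x - z) = R • (z - y) := by rw [hv, ← smul_sub]; congr 1; abel
      simp only
      rw [h3, heatKernel_smul hR ht]
      have : (R : ℂ) ^ d ≠ 0 := pow_ne_zero _ (by exact_mod_cast hR.ne')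
      push_cast
      field_simp
    simp_rw [h2]
    rw [integral_const_mul, integral_comp_smul_sub (fun w ↦ ψ w *
        (heatKernel d (R ^ 2 * t) (v - w) : ℂ)) hR, Complex.real_smul, ← mul_assoc,
      ← mul_assoc, ← Complex.ofReal_mul, ← Complex.ofReal_mul]
    congr 2
    rw [Real.mul_rpow (by positivity) ht.le, show 1 - α / 2 = -(α / 2 - 1) by ring,
      Real.rpow_neg (by positivity)]
    have : (R ^ 2) ^ (α / 2 - 1) ≠ 0 := by positivity
    field_simp
  have h4 := integral_comp_mul_left_Ioi (fun s ↦ ((s ^ (α / 2 - 1) : ℝ) : ℂ) *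
        ∫ w, ψ w * (heatKernel d s (v - w) : ℂ)) 0 (b := R ^ 2) (by positivity)
  rw [mul_zero, hΨ] at h4
  rw [rieszFun, setIntegral_congr_fun measurableSet_Ioi fun t ht ↦ h1 t ht, integral_const_mul, h4,
    dilatedKernel, Complex.real_smul, ← mul_assoc, ← Complex.ofReal_mul, ← hv, mul_left_comm]
  congr 2
  rw [mul_assoc, ← Real.rpow_neg_one (R ^ 2), ← Real.rpow_add (by positivity),
    ← Real.rpow_natCast R 2, ← Real.rpow_mul hR.le]
  congr 3
  push_cast
  ring

theorem lpKernel_sub_apply (Ξ : 𝓢(EuclideanSpace ℝ (Fin d), ℂ)) (k : ℤ)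
    (x z : EuclideanSpace ℝ (Fin d)) :
    (lpKernel Ξ k x - lpKernel Ξ (k - 1) x) z =
      ((((2 : ℝ) ^ k) ^ d : ℝ) : ℂ) * lpDiff Ξ ((2 : ℝ) ^ k • (x - z)) := by
  change lpKernel Ξ k x z - lpKernel Ξ (k - 1) x z = _
  rw [lpKernel_apply, lpKernel_apply, lpDiff_apply, smul_smul,
    show (2⁻¹ : ℝ) * 2 ^ k = 2 ^ (k - 1) by rw [zpow_sub_one₀ two_ne_zero, mul_comm], mul_sub]
  congr 1
  · push_cast
    rw [zpow_mul, zpow_natCast]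
  · push_cast
    rw [zpow_mul, zpow_natCast, ← mul_assoc, zpow_sub_one₀ two_ne_zero, mul_pow, inv_pow]

/-- The Littlewood-Paley pieces of `I_α μ` are convolutions of `μ` with dilates of one Schwartz
function. -/
theorem lpProj_eq_pairing {α : ℝ} (hα : 0 < α) {Ξ Ψ : 𝓢(EuclideanSpace ℝ (Fin d), ℂ)}
    (hΨ : ∀ v, ∫ t in Ioi (0 : ℝ), ((t ^ (α / 2 - 1) : ℝ) : ℂ) *
          ∫ w, lpDiff Ξ w * (heatKernel d t (v - w) : ℂ) = (Real.Gamma (α / 2) : ℂ) * Ψ v)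
    {μ : SignedMeasure (EuclideanSpace ℝ (Fin d))} {T : 𝓢'(EuclideanSpace ℝ (Fin d), ℂ)}
    (hT : ∀ g : 𝓢(EuclideanSpace ℝ (Fin d), ℂ),
        T g = pairing μ fun y ↦ ((1 / Real.Gamma (α / 2) : ℝ) : ℂ) * rieszFun α g y)
    (k : ℤ) (x : EuclideanSpace ℝ (Fin d)) :
    lpProj Ξ k T x = pairing μ fun y ↦ dilatedKernel α Ψ (2 ^ k) (x - y) := by
  have hG : (Real.Gamma (α / 2) : ℂ) ≠ 0 := by
    exact_mod_cast (Real.Gamma_pos_of_pos (half_pos hα)).ne'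
  rw [lpProj, lpLow, lpLow, ← map_sub, hT]
  congr 1
  ext y
  rw [funext (lpKernel_sub_apply Ξ k x), rieszFun_dilation hΨ (by positivity)]
  push_cast
  field_simp

/-! ### Estimates for a single atom -/

theorem enorm_pairing_le {X F : Type*} [MeasurableSpace X] [NormedAddCommGroup F]
    [NormedSpace ℝ F] (μ : SignedMeasure X) (f : X → F) :
    ‖pairing μ f‖ₑ ≤ ∫⁻ x, ‖f x‖ₑ ∂μ.totalVariation := by
  rw [SignedMeasure.totalVariation, lintegral_add_measure]
  exact (enorm_sub_le).trans (add_le_add (enorm_integral_le_lintegral_enorm _)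
    (enorm_integral_le_lintegral_enorm _))

theorem norm_pairing_le_of_ae_le {X F : Type*} [MeasurableSpace X] [NormedAddCommGroup F]
    [NormedSpace ℝ F] {μ : SignedMeasure X} (hμ : μ.totalVariation univ ≤ 1) {f : X → F} {C : ℝ}
    (hC : 0 ≤ C) (hf : ∀ᵐ x ∂μ.totalVariation, ‖f x‖ ≤ C) : ‖pairing μ f‖ ≤ C := by
  rw [← ENNReal.ofReal_le_ofReal_iff hC, ofReal_norm]
  calc _ ≤ ∫⁻ x, ‖f x‖ₑ ∂μ.totalVariation := enorm_pairing_le μ f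
    _ ≤ ∫⁻ _, ENNReal.ofReal C ∂μ.totalVariation := by
        refine lintegral_mono_ae ?_
        filter_upwards [hf] with x hx
        rw [← ofReal_norm]
        exact ENNReal.ofReal_le_ofReal hx
    _ ≤ _ := by
        rw [lintegral_const]
        exact mul_le_of_le_one_right' hμ

theorem isClosed_cube (c : EuclideanSpace ℝ (Fin d)) (l : ℝ) : IsClosed (cube c l) := by
  have : cube c l = ⋂ i, ({x | c i ≤ x i} ∩ {x | x i ≤ c i + l}) := by
    ext x
    simp [cube]
  rw [this]
  exact isClosed_iInter fun i ↦ (isClosed_le (by fun_prop) (by fun_prop)).inter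
    (isClosed_le (by fun_prop) (by fun_prop))

theorem norm_sub_le_of_mem_cube {c y : EuclideanSpace ℝ (Fin d)} {l : ℝ} (hl : 0 ≤ l)
    (hy : y ∈ cube c l) : ‖c - y‖ ≤ √d * l := by
  rw [EuclideanSpace.norm_eq, ← Real.sqrt_sq hl, ← Real.sqrt_mul (by positivity)]
  refine Real.sqrt_le_sqrt ?_
  calc ∑ i, ‖(c - y) i‖ ^ 2 ≤ ∑ _i : Fin d, l ^ 2 := by
        refine Finset.sum_le_sum fun i _ ↦ ?_
        have := hy i
        rw [Real.norm_eq_abs, sq_abs, PiLp.sub_apply]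
        nlinarith
    _ = _ := by simp

theorem ae_mem_cube {a : SignedMeasure (EuclideanSpace ℝ (Fin d))}
    {c : EuclideanSpace ℝ (Fin d)} {l : ℝ} (h : a.totalVariation.support ⊆ cube c l) :
    ∀ᵐ y ∂a.totalVariation, y ∈ cube c l := by
  filter_upwards [Measure.support_mem_ae (μ := a.totalVariation)] with y hy using h hy

theorem apply_univ_eq_zero {a : SignedMeasure (EuclideanSpace ℝ (Fin d))}
    {c : EuclideanSpace ℝ (Fin d)} {l : ℝ} (h : a.totalVariation.support ⊆ cube c l)
    (h0 : a (cube c l) = 0) : a univ = 0 := by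
  have h1 : a (cube c l)ᶜ = 0 := by
    rw [← norm_le_zero_iff]
    refine (SignedMeasure.norm_le_totalVariation a _).trans_eq ?_
    rw [Measure.real, ENNReal.toReal_eq_zero_iff]
    exact Or.inl (ae_mem_cube h)
  have hm := (isClosed_cube c l).measurableSet
  rw [← union_compl_self (cube c l), VectorMeasure.of_union disjoint_compl_right hm hm.compl,
    h0, h1, add_zero]

theorem continuous_dilatedKernel (α : ℝ) (Ψ : 𝓢(EuclideanSpace ℝ (Fin d), ℂ)) (R : ℝ) :
    Continuous (dilatedKernel α Ψ R) := by
  have := Ψ.continuous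
  unfold dilatedKernel
  fun_prop

theorem exists_norm_dilatedKernel_le (α : ℝ) (Ψ : 𝓢(EuclideanSpace ℝ (Fin d), ℂ)) (R : ℝ) :
    ∃ C, ∀ z, ‖dilatedKernel α Ψ R z‖ ≤ C := by
  refine ⟨‖((R ^ d * R ^ (-α) : ℝ) : ℂ)‖ * SchwartzMap.seminorm ℂ 0 0 Ψ, fun z ↦ ?_⟩
  rw [dilatedKernel, norm_mul]
  gcongr
  exact SchwartzMap.norm_le_seminorm ℂ Ψ _

theorem integrable_dilatedKernel_sub (α : ℝ) (Ψ : 𝓢(EuclideanSpace ℝ (Fin d), ℂ)) (R : ℝ)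
    (m : Measure (EuclideanSpace ℝ (Fin d))) [IsFiniteMeasure m] (x : EuclideanSpace ℝ (Fin d)) :
    Integrable (fun y ↦ dilatedKernel α Ψ R (x - y)) m := by
  obtain ⟨C, hC⟩ := exists_norm_dilatedKernel_le α Ψ R
  exact Integrable.of_bound
    ((continuous_dilatedKernel α Ψ R).comp (by fun_prop)).aestronglyMeasurable C
    (.of_forall fun y ↦ hC _)

theorem measurable_pairing_dilatedKernel (α : ℝ) (Ψ : 𝓢(EuclideanSpace ℝ (Fin d), ℂ)) (R : ℝ)
    (μ : SignedMeasure (EuclideanSpace ℝ (Fin d))) :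
    Measurable fun x ↦ pairing μ fun y ↦ dilatedKernel α Ψ R (x - y) := by
  have hc : Continuous fun z : EuclideanSpace ℝ (Fin d) × EuclideanSpace ℝ (Fin d) ↦
      dilatedKernel α Ψ R (z.1 - z.2) := (continuous_dilatedKernel α Ψ R).comp (by fun_prop)
  exact (hc.stronglyMeasurable.integral_prod_right'.sub
    hc.stronglyMeasurable.integral_prod_right').measurable

theorem lintegral_enorm_dilatedKernel (α : ℝ) (Ψ : 𝓢(EuclideanSpace ℝ (Fin d), ℂ)) {R : ℝ}
    (hR : 0 < R) (y : EuclideanSpace ℝ (Fin d)) :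
    ∫⁻ x, ‖dilatedKernel α Ψ R (x - y)‖ₑ = ENNReal.ofReal (R ^ (-α) * ∫ w, ‖Ψ w‖) := by
  have hi : Integrable (dilatedKernel α Ψ R) :=
    (Ψ.integrable.comp_smul hR.ne').const_mul _
  rw [lintegral_sub_right_eq_self (fun x ↦ ‖dilatedKernel α Ψ R x‖ₑ),
    ← ofReal_integral_norm_eq_lintegral_enorm hi]
  congr 1
  simp_rw [dilatedKernel, norm_mul, Complex.norm_real]
  rw [integral_const_mul, Measure.integral_comp_smul_of_nonneg volume (fun w ↦ ‖Ψ w‖) R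
    (hR := hR.le), finrank_euclideanSpace_fin, Real.norm_of_nonneg (by positivity), smul_eq_mul]
  field_simp

/-- Young's inequality for a measure of mass at most 1, with no cancellation; it serves the range Rl
> 1. -/
theorem lintegral_enorm_pairing_le {α : ℝ} (Ψ : 𝓢(EuclideanSpace ℝ (Fin d), ℂ)) {R : ℝ}
    (hR : 0 < R) {a : SignedMeasure (EuclideanSpace ℝ (Fin d))}
    (ha : a.totalVariation univ ≤ 1) :
    ∫⁻ x, ‖pairing a fun y ↦ dilatedKernel α Ψ R (x - y)‖ₑ ≤
      ENNReal.ofReal (R ^ (-α) * ∫ w, ‖Ψ w‖) := by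
  have hc : Continuous fun z : EuclideanSpace ℝ (Fin d) × EuclideanSpace ℝ (Fin d) ↦
      dilatedKernel α Ψ R (z.1 - z.2) := (continuous_dilatedKernel α Ψ R).comp (by fun_prop)
  calc _ ≤ ∫⁻ x, ∫⁻ y, ‖dilatedKernel α Ψ R (x - y)‖ₑ ∂a.totalVariation :=
        lintegral_mono fun x ↦ enorm_pairing_le _ _
    _ = ∫⁻ y, (∫⁻ x, ‖dilatedKernel α Ψ R (x - y)‖ₑ) ∂a.totalVariation :=
        lintegral_lintegral_swap hc.measurable.enorm.aemeasurable
    _ ≤ _ := by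
        simp_rw [lintegral_enorm_dilatedKernel α Ψ hR]
        rw [lintegral_const]
        exact mul_le_of_le_one_right' ha

/-- Schwartz functions are Lipschitz with an integrable local constant. -/
theorem exists_integrable_lipschitz (Ψ : 𝓢(EuclideanSpace ℝ (Fin d), ℂ)) {ρ : ℝ} (hρ : 0 ≤ ρ) :
    ∃ C : ℝ, 0 < C ∧ ∀ z w : EuclideanSpace ℝ (Fin d), ‖w‖ ≤ ρ →
      ‖Ψ (z + w) - Ψ z‖ ≤ ‖w‖ * (C * (1 + ‖z‖) ^ (-(d + 1 : ℝ))) := by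
  set D := SchwartzMap.fderivCLM ℂ (EuclideanSpace ℝ (Fin d)) ℂ Ψ with hD
  set B := 2 ^ (d + 1) * (Finset.Iic (d + 1, 0)).sup
    (schwartzSeminormFamily ℂ (EuclideanSpace ℝ (Fin d)) _) D with hB
  have hB0 : 0 ≤ B := by positivity
  have hdec : ∀ x, ‖fderiv ℝ Ψ x‖ ≤ B * (1 + ‖x‖) ^ (-(d + 1 : ℝ)) := fun x ↦ by
    have h := SchwartzMap.one_add_le_sup_seminorm_apply (𝕜 := ℂ) (m := (d + 1, 0))
      (le_refl (d + 1)) (le_refl 0) D x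
    rw [norm_iteratedFDeriv_zero, hD, SchwartzMap.fderivCLM_apply] at h
    have h' : (1 + ‖x‖) ^ (d + 1) * ‖fderiv ℝ Ψ x‖ ≤ B := h
    rw [Real.rpow_neg (by positivity), ← div_eq_mul_inv, le_div_iff₀ (by positivity), mul_comm]
    exact_mod_cast h'
  refine ⟨B * (1 + ρ) ^ (d + 1 : ℝ) + 1, by positivity, fun z w hw ↦ ?_⟩
  have hseg : ∀ x ∈ segment ℝ z (z + w), ‖fderiv ℝ Ψ x‖ ≤
      (B * (1 + ρ) ^ (d + 1 : ℝ) + 1) * (1 + ‖z‖) ^ (-(d + 1 : ℝ)) := fun x hx ↦ by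
    have hzx : ‖z - x‖ ≤ ‖w‖ := by
      have := norm_sub_le_of_mem_segment hx
      rw [norm_sub_rev]
      simpa using this
    -- Displacements are at most ρ, so the decay weight at x on the segment transfers to z at the
    -- cost of (1 + ρ)^{d+1}. The exponent d + 1 makes the weight integrable.
    have h1 : 1 + ‖z‖ ≤ (1 + ρ) * (1 + ‖x‖) := by
      have : ‖z‖ ≤ ‖x‖ + ‖z - x‖ := by simpa using norm_add_le x (z - x)
      nlinarith [norm_nonneg x]
    have h2 : (1 + ‖x‖) ^ (-(d + 1 : ℝ)) ≤
        (1 + ρ) ^ (d + 1 : ℝ) * (1 + ‖z‖) ^ (-(d + 1 : ℝ)) := by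
      rw [Real.rpow_neg (by positivity), Real.rpow_neg (by positivity), ← div_eq_mul_inv,
        le_div_iff₀ (by positivity), inv_mul_le_iff₀ (by positivity), mul_comm,
        ← Real.mul_rpow (by positivity) (by positivity)]
      exact Real.rpow_le_rpow (by positivity) h1 (by positivity)
    calc _ ≤ B * (1 + ‖x‖) ^ (-(d + 1 : ℝ)) := hdec x
      _ ≤ B * ((1 + ρ) ^ (d + 1 : ℝ) * (1 + ‖z‖) ^ (-(d + 1 : ℝ))) := by gcongr
      _ ≤ _ := by
          rw [← mul_assoc]
          gcongr
          linarith
  have h := (convex_segment z (z + w)).norm_image_sub_le_of_norm_fderiv_le (𝕜 := ℝ)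
    (fun x _ ↦ Ψ.differentiableAt) hseg (left_mem_segment ℝ _ _) (right_mem_segment ℝ _ _)
  rw [add_sub_cancel_left, mul_comm] at h
  exact h

/-- The low frequency estimate: cancellation. -/
theorem exists_low_frequency_bounds (α : ℝ) (Ψ : 𝓢(EuclideanSpace ℝ (Fin d), ℂ)) :
    ∃ C : ℝ, 0 < C ∧ ∀ (a : SignedMeasure (EuclideanSpace ℝ (Fin d)))
      (c : EuclideanSpace ℝ (Fin d)) (l : ℝ), 0 < l → a.totalVariation.support ⊆ cube c l →
      a (cube c l) = 0 → a.totalVariation univ ≤ 1 → ∀ R : ℝ, 0 < R → R * l ≤ 1 →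
        ∫⁻ x, ‖pairing a fun y ↦ dilatedKernel α Ψ R (x - y)‖ₑ ≤
          ENNReal.ofReal (C * (R ^ (-α) * (R * l))) ∧
        ∀ x, ‖pairing a fun y ↦ dilatedKernel α Ψ R (x - y)‖ ≤
          C * (R ^ d * R ^ (-α) * (R * l)) := by
  obtain ⟨B, hB, hΨ⟩ := exists_integrable_lipschitz Ψ (Real.sqrt_nonneg d)
  set g : EuclideanSpace ℝ (Fin d) → ℝ := fun z ↦ (1 + ‖z‖) ^ (-(d + 1 : ℝ)) with hg
  have hg0 : ∀ z, 0 ≤ g z := fun z ↦ by rw [hg]; positivity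
  have hg1 : ∀ z, g z ≤ 1 := fun z ↦
    Real.rpow_le_one_of_one_le_of_nonpos (by linarith [norm_nonneg z])
      (by have : (0 : ℝ) ≤ d := by positivity
          linarith)
  have hgi : Integrable g := integrable_one_add_norm (by simp)
  have hI0 : 0 ≤ ∫ z, g z := integral_nonneg hg0
  refine ⟨√d * B * (∫ z, g z) + √d * B + 1, by positivity, ?_⟩
  intro a c l hl hs h0 h1 R hR hRl
  have hpt : ∀ x, ‖pairing a fun y ↦ dilatedKernel α Ψ R (x - y)‖ ≤
      R ^ d * R ^ (-α) * (√d * (R * l)) * (B * g (R • (x - c))) := fun x ↦ by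
    -- The atom has zero total mass, so the kernel value at the corner c may be subtracted. As Rl ≤
    -- 1, the rescaled displacement R(c - y) stays within √d, and the Lipschitz bound yields the
    -- factor Rl.
    have e : (pairing a fun y ↦ dilatedKernel α Ψ R (x - y)) =
        pairing a fun y ↦ dilatedKernel α Ψ R (x - y) - dilatedKernel α Ψ R (x - c) := by
      have hc := pairing_const a (dilatedKernel α Ψ R (x - c))
      rw [apply_univ_eq_zero hs h0, zero_smul] at hc
      rw [← sub_zero (pairing a fun y ↦ dilatedKernel α Ψ R (x - y)), ← hc]
      simp only [pairing]
      rw [integral_sub (integrable_dilatedKernel_sub ..) (integrable_const _),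
        integral_sub (integrable_dilatedKernel_sub ..) (integrable_const _)]
      abel
    rw [e]
    refine norm_pairing_le_of_ae_le h1 (by have := hg0 (R • (x - c)); positivity) ?_
    filter_upwards [ae_mem_cube hs] with y hy
    have hcy : ‖R • (c - y)‖ ≤ √d * (R * l) := by
      rw [norm_smul, Real.norm_of_nonneg hR.le]
      calc R * ‖c - y‖ ≤ R * (√d * l) := by gcongr; exact norm_sub_le_of_mem_cube hl.le hy
        _ = _ := by ring
    have h2 := hΨ (R • (x - c)) (R • (c - y)) (hcy.trans
      (mul_le_of_le_one_right (Real.sqrt_nonneg _) hRl))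
    rw [← smul_add, sub_add_sub_cancel] at h2
    rw [dilatedKernel, dilatedKernel, ← mul_sub, norm_mul, Complex.norm_real,
      Real.norm_of_nonneg (by positivity), mul_assoc (R ^ d * R ^ (-α))]
    refine mul_le_mul_of_nonneg_left (h2.trans ?_) (by positivity)
    have := hg0 (R • (x - c))
    gcongr
  constructor
  · calc _ ≤ ∫⁻ x, ENNReal.ofReal
          (R ^ d * R ^ (-α) * (√d * (R * l)) * (B * g (R • (x - c)))) := by
          refine lintegral_mono fun x ↦ ?_
          rw [← ofReal_norm]
          exact ENNReal.ofReal_le_ofReal (hpt x)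
      _ = ENNReal.ofReal (∫ x, R ^ d * R ^ (-α) * (√d * (R * l)) * (B * g (R • (x - c)))) := by
          refine (ofReal_integral_eq_lintegral_ofReal ?_ (.of_forall fun x ↦ ?_)).symm
          · exact (((hgi.comp_smul hR.ne').comp_sub_right c).const_mul B).const_mul _
          · have := hg0 (R • (x - c))
            simp only [Pi.zero_apply]
            positivity
      _ ≤ _ := by
          refine ENNReal.ofReal_le_ofReal ?_
          rw [integral_const_mul, integral_const_mul,
            integral_sub_right_eq_self (fun x ↦ g (R • x)),
            Measure.integral_comp_smul_of_nonneg volume g R (hR := hR.le),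
            finrank_euclideanSpace_fin, smul_eq_mul]
          calc _ = (√d * B * ∫ z, g z) * (R ^ (-α) * (R * l)) := by field_simp
            _ ≤ _ := by
                gcongr
                have : 0 ≤ √d * B := by positivity
                linarith
  · intro x
    calc _ ≤ R ^ d * R ^ (-α) * (√d * (R * l)) * (B * 1) := by
          refine (hpt x).trans ?_
          gcongr
          exact hg1 _
      _ = √d * B * (R ^ d * R ^ (-α) * (R * l)) := by ring
      _ ≤ _ := by
          gcongr
          have : 0 ≤ √d * B * ∫ z, g z := by positivity
          linarith

/-- The high frequency estimate: the Morrey bound. -/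
theorem norm_pairing_dilatedKernel_le {α β : ℝ} {Ψ Φ : 𝓢(EuclideanSpace ℝ (Fin d), ℂ)}
    (hΨ : ∀ v, Ψ v = ∫ w, Φ w * (heatKernel d 1 (v - w) : ℂ))
    {a : SignedMeasure (EuclideanSpace ℝ (Fin d))} {l : ℝ}
    (hheat : ∀ (x : EuclideanSpace ℝ (Fin d)) (t : ℝ), 0 < t →
      |t ^ (((d : ℝ) - β) / 2) * heat a t x| ≤ 1 / l ^ β) {R : ℝ} (hR : 0 < R)
    (x : EuclideanSpace ℝ (Fin d)) :
    ‖pairing a fun y ↦ dilatedKernel α Ψ R (x - y)‖ ≤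
      (∫ w, ‖Φ w‖) * (R ^ (-α) * (R ^ ((d : ℝ) - β) * (1 / l ^ β))) := by
  set s : ℝ := (R ^ 2)⁻¹ with hs
  have hs0 : 0 < s := by positivity
  -- By Ψ = e^Δ Φ and scaling, frequency R corresponds to heat time s = R^{-2}; the factor R^d is
  -- absorbed by the rescaled heat kernel.
  have hK : ∀ y, dilatedKernel α Ψ R (x - y) =
      ((R ^ (-α) : ℝ) : ℂ) * ∫ w, Φ w * (heatKernel d s (x - R⁻¹ • w - y) : ℂ) := fun y ↦ by
    rw [dilatedKernel, hΨ, ← integral_const_mul, ← integral_const_mul]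
    congr 1 with w
    have h1 := heatKernel_smul hR hs0 (x - R⁻¹ • w - y)
    rw [hs, mul_inv_cancel₀ (by positivity), ← hs, smul_sub, smul_sub,
      smul_inv_smul₀ hR.ne', sub_right_comm, ← smul_sub] at h1
    rw [h1]
    have : (R : ℂ) ^ d ≠ 0 := pow_ne_zero _ (by exact_mod_cast hR.ne')
    push_cast
    field_simp
  have hswap : ∀ (m : Measure (EuclideanSpace ℝ (Fin d))) [IsFiniteMeasure m],
      Integrable (fun z : EuclideanSpace ℝ (Fin d) × EuclideanSpace ℝ (Fin d) ↦
        Φ z.2 * (heatKernel d s (x - R⁻¹ • z.2 - z.1) : ℂ)) (m.prod volume) := fun m _ ↦ by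
    have hc : Continuous (heatKernel d s) := continuous_heatKernel s
    have hΦ := Φ.continuous
    refine ((integrable_const ((4 * Real.pi * s) ^ (-((d : ℝ) / 2)))).mul_prod
      Φ.integrable.norm).mono' ?_ (.of_forall fun z ↦ ?_)
    · exact Continuous.aestronglyMeasurable (by fun_prop)
    · rw [norm_mul, mul_comm, Complex.norm_real, Real.norm_of_nonneg (heatKernel_nonneg hs0 _)]
      gcongr
      exact heatKernel_le hs0 _
  have hpair : (pairing a fun y ↦ dilatedKernel α Ψ R (x - y)) =
      ((R ^ (-α) : ℝ) : ℂ) * ∫ w, Φ w * (heat a s (x - R⁻¹ • w) : ℂ) := by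
    have hm : ∀ (m : Measure (EuclideanSpace ℝ (Fin d))) [IsFiniteMeasure m],
        ∫ y, dilatedKernel α Ψ R (x - y) ∂m = ((R ^ (-α) : ℝ) : ℂ) *
          ∫ w, ∫ y, Φ w * (heatKernel d s (x - R⁻¹ • w - y) : ℂ) ∂m := fun m _ ↦ by
      simp_rw [hK]
      rw [integral_const_mul, integral_integral_swap (hswap m)]
    rw [pairing, hm, hm, ← mul_sub,
      ← integral_sub (hswap _).integral_prod_right (hswap _).integral_prod_right]
    congr 2 with w
    dsimp only
    rw [heat_eq_pairing a hs0, pairing, integral_const_mul, integral_const_mul,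
      integral_complex_ofReal, integral_complex_ofReal]
    push_cast
    ring
  rw [hpair, norm_mul, Complex.norm_real, Real.norm_of_nonneg (by positivity), mul_left_comm]
  gcongr
  have hsR : s ^ (((d : ℝ) - β) / 2) = (R ^ ((d : ℝ) - β))⁻¹ := by
    rw [hs, Real.inv_rpow (by positivity), ← Real.rpow_natCast R 2, ← Real.rpow_mul hR.le]
    congr 2
    push_cast
    ring
  have hb : ∀ w, ‖Φ w * (heat a s (x - R⁻¹ • w) : ℂ)‖ ≤
      ‖Φ w‖ * (R ^ ((d : ℝ) - β) * (1 / l ^ β)) := fun w ↦ by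
    rw [norm_mul, Complex.norm_real, Real.norm_eq_abs]
    gcongr
    have h := hheat (x - R⁻¹ • w) s hs0
    rw [abs_mul, hsR, abs_of_pos (by positivity), inv_mul_le_iff₀ (by positivity)] at h
    exact h
  refine (norm_integral_le_of_norm_le (Φ.integrable.norm.mul_const _) (.of_forall hb)).trans_eq ?_
  rw [integral_mul_const]

/-- The `L¹` and `L^∞` bounds of the Littlewood-Paley pieces of an atom. -/
theorem exists_atom_bounds {α β : ℝ} (hα : 0 < α) (hαd : α < d) (hβ : 0 < β)
    {Ψ Φ : 𝓢(EuclideanSpace ℝ (Fin d), ℂ)}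
    (hΨ : ∀ v, Ψ v = ∫ w, Φ w * (heatKernel d 1 (v - w) : ℂ)) :
    ∃ C : ℝ, 0 < C ∧ ∀ a : SignedMeasure (EuclideanSpace ℝ (Fin d)), IsAtom β a →
      ∃ l : ℝ, 0 < l ∧ ∀ R : ℝ, 0 < R → ∃ A M : ℝ, 0 < A ∧ 0 < M ∧
        ∫⁻ x, ‖pairing a fun y ↦ dilatedKernel α Ψ R (x - y)‖ₑ ≤ ENNReal.ofReal A ∧
        (∀ x, ‖pairing a fun y ↦ dilatedKernel α Ψ R (x - y)‖ ≤ M) ∧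
        A ^ (1 - α / d) * M ^ (α / d) ≤ C * min (R * l) ((R * l) ^ (-(α * β / d))) := by
  have hd : (0 : ℝ) < d := hα.trans hαd
  obtain ⟨C₀, hC₀, hlow⟩ := exists_low_frequency_bounds α Ψ
  have hI1 : 0 ≤ ∫ w, ‖Ψ w‖ := by positivity
  have hI2 : 0 ≤ ∫ w, ‖Φ w‖ := by positivity
  set C₁ := (∫ w, ‖Ψ w‖) + (∫ w, ‖Φ w‖) + 1 with hC₁
  have hC₁0 : 0 < C₁ := by positivity
  -- Here CP is the L¹ bound and CPQ the L^∞ bound. For Rl ≤ 1, P = R^{-α}(Rl) and Q = R^d;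
  -- otherwise P = R^{-α} and Q = R^{d-β} l^{-β}. In both cases P Q^{α/d} depends only on Rl.
  have hpow : ∀ C P Q : ℝ, 0 < C → 0 < P → 0 < Q →
      (C * P) ^ (1 - α / d) * (C * (P * Q)) ^ (α / d) = C * (P * Q ^ (α / d)) := by
    intro C P Q hC hP hQ
    rw [← mul_assoc C P Q, Real.mul_rpow (x := C * P) (by positivity) hQ.le, ← mul_assoc,
      ← Real.rpow_add (by positivity), sub_add_cancel, Real.rpow_one, mul_assoc]
  refine ⟨max C₀ C₁, lt_max_of_lt_left hC₀, ?_⟩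
  rintro a ⟨c, l, hl, hs, h0, hheat, h1⟩
  refine ⟨l, hl, fun R hR ↦ ?_⟩
  have hq : 0 < R * l := by positivity
  have hγ : 0 ≤ α * β / d := by positivity
  rcases le_or_gt (R * l) 1 with hRl | hRl
  · obtain ⟨hA, hM⟩ := hlow a c l hl hs h0 h1 R hR hRl
    refine ⟨_, C₀ * (R ^ (-α) * (R * l) * R ^ d), by positivity, by positivity, hA, fun x ↦ ?_, ?_⟩
    · exact (hM x).trans_eq (by ring)
    · rw [hpow _ _ _ hC₀ (by positivity) (by positivity), min_eq_left]
      · have h2 : R ^ (-α) * (R ^ d) ^ (α / d) = 1 := by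
          rw [← Real.rpow_natCast R d, ← Real.rpow_mul hR.le, ← Real.rpow_add hR,
            mul_div_cancel₀ _ hd.ne', neg_add_cancel, Real.rpow_zero]
        calc _ = C₀ * (R * l) * (R ^ (-α) * (R ^ d) ^ (α / d)) := by ring
          _ ≤ _ := by
              rw [h2, mul_one]
              gcongr
              exact le_max_left _ _
      · exact hRl.trans (Real.one_le_rpow_of_pos_of_le_one_of_nonpos hq hRl (by linarith))
  · refine ⟨C₁ * R ^ (-α), C₁ * (R ^ (-α) * (R ^ ((d : ℝ) - β) * (1 / l ^ β))), by positivity,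
      by positivity, (lintegral_enorm_pairing_le Ψ hR h1).trans (ENNReal.ofReal_le_ofReal ?_),
      fun x ↦ (norm_pairing_dilatedKernel_le hΨ hheat hR x).trans ?_, ?_⟩
    · rw [mul_comm]
      gcongr
      linarith
    · gcongr
      linarith
    · rw [hpow _ _ _ hC₁0 (by positivity) (by positivity), min_eq_right]
      · have h2 : R ^ (-α) * (R ^ ((d : ℝ) - β) * (1 / l ^ β)) ^ (α / d) =
            (R * l) ^ (-(α * β / d)) := by
          rw [Real.mul_rpow (by positivity) (by positivity), one_div, ← Real.rpow_neg hl.le,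
            ← Real.rpow_mul hR.le, ← Real.rpow_mul hl.le, ← mul_assoc, ← Real.rpow_add hR,
            Real.mul_rpow hR.le hl.le]
          congr 2
          · field_simp
            ring
          · ring
        rw [h2]
        gcongr
        exact le_max_right _ _
      · exact (Real.rpow_le_one_of_one_le_of_nonpos hRl.le (by linarith)).trans hRl.le

/-! ### Summation over scales and passage to the limit -/

/-- A dyadic sum, uniformly in the scale. -/
theorem exists_tsum_min_le {γ : ℝ} (hγ : 0 < γ) :
    ∃ C : ℝ, 0 < C ∧ ∀ l : ℝ, 0 < l →
      ∑' k : ℤ, ENNReal.ofReal (min ((2 : ℝ) ^ k * l) (((2 : ℝ) ^ k * l) ^ (-γ))) ≤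
        ENNReal.ofReal C := by
  -- The ratio 1/2 governs k ≤ 0 and 2^{-γ} governs k ≥ 0; the factor 2 below comes from r < 2.
  set ρ : ℝ := max (1 / 2) ((2 : ℝ) ^ (-γ)) with hρ
  have hρ0 : 0 < ρ := by positivity
  have hρ1 : ρ < 1 := max_lt (by norm_num) (Real.rpow_lt_one_of_one_lt_of_neg one_lt_two (by linarith))
  have hsum : Summable fun k : ℤ ↦ 2 * ρ ^ k.natAbs := by
    refine Summable.mul_left _ (Summable.of_nat_of_neg ?_ ?_) <;>
    simpa using summable_geometric_of_lt_one hρ0.le hρ1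
  have hbase : ∀ r : ℝ, 1 ≤ r → r < 2 → ∀ k : ℤ,
      min ((2 : ℝ) ^ k * r) (((2 : ℝ) ^ k * r) ^ (-γ)) ≤ 2 * ρ ^ k.natAbs := by
    intro r hr1 hr2 k
    rcases le_total 0 k with hk | hk
    · lift k to ℕ using hk
      refine (min_le_right _ _).trans ?_
      rw [zpow_natCast, Int.natAbs_natCast]
      calc ((2 : ℝ) ^ k * r) ^ (-γ) ≤ ((2 : ℝ) ^ k) ^ (-γ) := by
            refine Real.rpow_le_rpow_of_nonpos (by positivity) ?_ (by linarith)
            exact le_mul_of_one_le_right (by positivity) hr1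
        _ = ((2 : ℝ) ^ (-γ)) ^ k := by
            rw [← Real.rpow_natCast, ← Real.rpow_natCast, ← Real.rpow_mul zero_le_two,
              ← Real.rpow_mul zero_le_two, mul_comm]
        _ ≤ ρ ^ k := by gcongr; exact le_max_right _ _
        _ ≤ 2 * ρ ^ k := le_mul_of_one_le_left (by positivity) one_le_two
    · obtain ⟨n, rfl⟩ := Int.exists_eq_neg_ofNat hk
      refine (min_le_left _ _).trans ?_
      rw [Int.natAbs_neg, Int.natAbs_natCast, zpow_neg, zpow_natCast, mul_comm]
      gcongr
      rw [← inv_pow]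
      gcongr
      exact (by norm_num : (2 : ℝ)⁻¹ ≤ 1 / 2).trans (le_max_left _ _)
  have h0 : (0 : ℝ) < ∑' k : ℤ, 2 * ρ ^ k.natAbs :=
    hsum.tsum_pos (fun k ↦ by positivity) 0 (by positivity)
  refine ⟨_, h0, fun l hl ↦ ?_⟩
  -- Writing l = 2^j r with 1 ≤ r < 2 and shifting k by j makes the bound independent of l.
  obtain ⟨j, hj1, hj2⟩ := exists_mem_Ico_zpow hl one_lt_two
  set r := l * (2 : ℝ) ^ (-j) with hr
  have hr1 : 1 ≤ r := by
    rw [hr, zpow_neg, ← div_eq_mul_inv, one_le_div (by positivity)]; exact hj1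
  have hr2 : r < 2 := by
    rw [hr, zpow_neg, ← div_eq_mul_inv, div_lt_iff₀ (by positivity), mul_comm,
      ← zpow_add_one₀ two_ne_zero]
    exact hj2
  rw [ENNReal.ofReal_tsum_of_nonneg (fun k ↦ by positivity) hsum,
    ← (Equiv.subRight j).tsum_eq]
  refine ENNReal.tsum_le_tsum fun k ↦ ENNReal.ofReal_le_ofReal ?_
  have : (2 : ℝ) ^ ((Equiv.subRight j) k) * l = 2 ^ k * r := by
    rw [hr, Equiv.subRight_apply, sub_eq_add_neg, zpow_add₀ two_ne_zero]
    ring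
  rw [this]
  exact hbase r hr1 hr2 k

/-- The convolution of an atomic limit with a dilated kernel. -/
theorem IsAtomicLimit.tendsto_pairing {β : ℝ} {μ : SignedMeasure (EuclideanSpace ℝ (Fin d))}
    {c : ℕ → ℕ → ℝ} {a : ℕ → ℕ → SignedMeasure (EuclideanSpace ℝ (Fin d))}
    (h : IsAtomicLimit β μ c a) (g : 𝓢(EuclideanSpace ℝ (Fin d), ℂ)) :
    Tendsto (fun n ↦ ∑ i ∈ Finset.range n, (c n i : ℂ) * pairing (a n i) g) atTop
      (𝓝 (pairing μ g)) := by
  have hgi : ∀ m : Measure (EuclideanSpace ℝ (Fin d)), IsFiniteMeasure m → Integrable g m :=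
    fun m _ ↦ Integrable.of_bound g.continuous.aestronglyMeasurable _
      (.of_forall (SchwartzMap.norm_le_seminorm ℂ g))
  -- The C₀ test functions are real-valued, so the limit is taken for real-linear functionals of g
  -- and reassembled from real and imaginary parts.
  have key : ∀ L : ℂ →L[ℝ] ℝ,
      Tendsto (fun n ↦ L (∑ i ∈ Finset.range n, (c n i : ℂ) * pairing (a n i) g)) atTop
      (𝓝 (L (pairing μ g))) := fun L ↦ by
    let φ : C₀(EuclideanSpace ℝ (Fin d), ℝ) :=
      ⟨⟨fun x ↦ L (g x), L.continuous.comp g.continuous⟩, by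
        have := (L.continuous.tendsto 0).comp g.tendsto_cocompact
        rwa [map_zero] at this⟩
    have hφ : ∀ ν : SignedMeasure (EuclideanSpace ℝ (Fin d)),
        ∫ᵛ x, φ x ∂<•ν = L (pairing ν g) := fun ν ↦ by
      have h1 : ∫ᵛ x, φ x ∂<•ν = pairing ν fun x ↦ L (g x) :=
        integral_eq_pairing ν (L.integrable_comp (hgi _ inferInstance))
      rw [h1, pairing, pairing, map_sub, ← L.integral_comp_comm (hgi _ inferInstance),
        ← L.integral_comp_comm (hgi _ inferInstance)]
    have h2 := h.2 φ
    simp_rw [hφ] at h2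
    refine h2.congr fun n ↦ ?_
    rw [map_sum]
    refine Finset.sum_congr rfl fun i _ ↦ ?_
    rw [← Complex.real_smul, map_smul, smul_eq_mul]
  have hre := (Complex.continuous_ofReal.tendsto _).comp (key Complex.reCLM)
  have him := ((Complex.continuous_ofReal.tendsto _).comp (key Complex.imCLM)).mul_const Complex.I
  have := hre.add him
  simpa only [Function.comp_def, Complex.reCLM_apply, Complex.imCLM_apply,
    Complex.re_add_im] using this

/-- This makes the kernel at fixed x an admissible test function, so weak-star convergence becomes
pointwise convergence of the pieces. -/
theorem dilatedKernel_sub_eq_schwartz (α : ℝ) (Ψ : 𝓢(EuclideanSpace ℝ (Fin d), ℂ)) (k : ℤ)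
    (x : EuclideanSpace ℝ (Fin d)) :
    ∃ g : 𝓢(EuclideanSpace ℝ (Fin d), ℂ), ∀ y, g y = dilatedKernel α Ψ (2 ^ k) (x - y) := by
  refine ⟨(((((2 : ℝ) ^ k) ^ d * ((2 : ℝ) ^ k) ^ (-α) : ℝ) : ℂ) * ((2 : ℂ) ^ (k * (d : ℤ)))⁻¹) •
    lpKernel Ψ k x, fun y ↦ ?_⟩
  change _ * lpKernel Ψ k x y = _
  rw [lpKernel_apply, dilatedKernel, mul_assoc, inv_mul_cancel_left₀ (zpow_ne_zero _ two_ne_zero)]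

/-- The Besov-Lorentz bound for atomic limits. -/
theorem tsum_lorentzNorm_pairing_le {α β : ℝ} (hα : 0 < α) (hαd : α < d) (hβ : 0 < β)
    {Ψ Φ : 𝓢(EuclideanSpace ℝ (Fin d), ℂ)}
    (hΨ : ∀ v, Ψ v = ∫ w, Φ w * (heatKernel d 1 (v - w) : ℂ)) :
    ∃ C : ℝ, 0 < C ∧ ∀ (μ : SignedMeasure (EuclideanSpace ℝ (Fin d))) (c : ℕ → ℕ → ℝ)
      (a : ℕ → ℕ → SignedMeasure (EuclideanSpace ℝ (Fin d))), IsAtomicLimit β μ c a →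
      ∑' k : ℤ, lorentzNorm ((d : ℝ) / ((d : ℝ) - α))
        (fun x ↦ pairing μ fun y ↦ dilatedKernel α Ψ (2 ^ k) (x - y)) ≤
        ENNReal.ofReal C * atomicCost c := by
  have hd : (0 : ℝ) < d := hα.trans hαd
  have hdα : (0 : ℝ) < d - α := by linarith
  set p : ℝ := (d : ℝ) / ((d : ℝ) - α) with hp
  have hp1 : 1 < p := by rw [hp, one_lt_div hdα]; linarith
  have hp' : 1 / p = 1 - α / d := by rw [hp]; field_simp
  have hp'' : 1 - 1 / p = α / d := by rw [hp']; ring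
  have hK0 : 0 < 2 * (p + p / (p - 1)) := by
    have : 0 < p - 1 := by linarith
    positivity
  obtain ⟨C₁, hC₁, hatom⟩ := exists_atom_bounds hα hαd hβ hΨ
  obtain ⟨C₂, hC₂, hsum⟩ := exists_tsum_min_le (γ := α * β / d) (by positivity)
  set K := 2 * (p + p / (p - 1))
  refine ⟨K * C₁ * C₂, by positivity, fun μ c a h ↦ ?_⟩
  set F : ℕ → ℤ → EuclideanSpace ℝ (Fin d) → ℂ := fun n k x ↦ ∑ i ∈ Finset.range n,
    (c n i : ℂ) * pairing (a n i) fun y ↦ dilatedKernel α Ψ (2 ^ k) (x - y) with hF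
  have hFm : ∀ n k, Measurable (F n k) := fun n k ↦ Finset.measurable_sum _ fun i _ ↦
    (measurable_pairing_dilatedKernel α Ψ _ _).const_mul _
  have hFlim : ∀ k x, Tendsto (fun n ↦ F n k x) atTop
      (𝓝 (pairing μ fun y ↦ dilatedKernel α Ψ (2 ^ k) (x - y))) := fun k x ↦ by
    obtain ⟨g, hg⟩ := dilatedKernel_sub_eq_schwartz α Ψ k x
    simpa only [funext hg] using h.tendsto_pairing g
  have hFn : ∀ n, ∑' k : ℤ, lorentzNorm p (F n k) ≤
      ENNReal.ofReal (K * C₁ * C₂) * ∑ i ∈ Finset.range n, ENNReal.ofReal |c n i| := fun n ↦ by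
    have hex : ∀ i, ∃ l : ℝ, i < n → 0 < l ∧ ∀ R : ℝ, 0 < R → ∃ A M : ℝ, 0 < A ∧ 0 < M ∧
        ∫⁻ x, ‖pairing (a n i) fun y ↦ dilatedKernel α Ψ R (x - y)‖ₑ ≤ ENNReal.ofReal A ∧
        (∀ x, ‖pairing (a n i) fun y ↦ dilatedKernel α Ψ R (x - y)‖ ≤ M) ∧
        A ^ (1 - α / d) * M ^ (α / d) ≤ C₁ * min (R * l) ((R * l) ^ (-(α * β / d))) := fun i ↦ by
      by_cases hi : i < n
      · obtain ⟨l, hl⟩ := hatom _ (h.1 n i hi)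
        exact ⟨l, fun _ ↦ hl⟩
      · exact ⟨0, fun h ↦ absurd h hi⟩
    choose l hl using hex
    have hk : ∀ k : ℤ, lorentzNorm p (F n k) ≤ ∑ i ∈ Finset.range n, ENNReal.ofReal |c n i| *
        (ENNReal.ofReal (K * C₁) * ENNReal.ofReal (min ((2 : ℝ) ^ k * l i)
          (((2 : ℝ) ^ k * l i) ^ (-(α * β / d))))) := fun k ↦ by
      have hex2 : ∀ i, ∃ A M : ℝ, i < n → 0 < A ∧ 0 < M ∧
          ∫⁻ x, ‖pairing (a n i) fun y ↦ dilatedKernel α Ψ (2 ^ k) (x - y)‖ₑ ≤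
            ENNReal.ofReal A ∧
          (∀ x, ‖pairing (a n i) fun y ↦ dilatedKernel α Ψ (2 ^ k) (x - y)‖ ≤ M) ∧
          A ^ (1 - α / d) * M ^ (α / d) ≤
            C₁ * min ((2 : ℝ) ^ k * l i) (((2 : ℝ) ^ k * l i) ^ (-(α * β / d))) := fun i ↦ by
        by_cases hi : i < n
        · obtain ⟨A, M, hAM⟩ := (hl i hi).2 (2 ^ k) (by positivity)
          exact ⟨A, M, fun _ ↦ hAM⟩
        · exact ⟨0, 0, fun h ↦ absurd h hi⟩
      choose A M hAM using hex2
      have hmem : ∀ i ∈ Finset.range n, i < n := fun i hi ↦ Finset.mem_range.1 hi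
      refine (lorentzNorm_sum_le hp1 (Finset.range n)
        (fun i _ ↦ measurable_pairing_dilatedKernel α Ψ _ _)
        (fun i hi ↦ (hAM i (hmem i hi)).1) (fun i hi ↦ (hAM i (hmem i hi)).2.1) (c n)
        (fun i hi ↦ (hAM i (hmem i hi)).2.2.1)
        (fun i hi ↦ (hAM i (hmem i hi)).2.2.2.1)).trans (Finset.sum_le_sum fun i hi ↦ ?_)
      refine mul_le_mul_right ?_ _
      rw [← ENNReal.ofReal_mul (p := K * C₁) (by positivity), hp'', hp', mul_assoc K C₁]
      exact ENNReal.ofReal_le_ofReal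
        (mul_le_mul_of_nonneg_left (hAM i (hmem i hi)).2.2.2.2 hK0.le)
    calc _ ≤ ∑' k : ℤ, ∑ i ∈ Finset.range n, ENNReal.ofReal |c n i| *
        (ENNReal.ofReal (K * C₁) * ENNReal.ofReal (min ((2 : ℝ) ^ k * l i)
          (((2 : ℝ) ^ k * l i) ^ (-(α * β / d))))) := ENNReal.tsum_le_tsum hk
      _ = ∑ i ∈ Finset.range n, ENNReal.ofReal |c n i| * (ENNReal.ofReal (K * C₁) *
          ∑' k : ℤ, ENNReal.ofReal (min ((2 : ℝ) ^ k * l i)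
          (((2 : ℝ) ^ k * l i) ^ (-(α * β / d))))) := by
          rw [Summable.tsum_finsetSum fun i _ ↦ ENNReal.summable]
          simp_rw [ENNReal.tsum_mul_left]
      _ ≤ ∑ i ∈ Finset.range n, ENNReal.ofReal |c n i| *
          (ENNReal.ofReal (K * C₁) * ENNReal.ofReal C₂) := by
          refine Finset.sum_le_sum fun i hi ↦ ?_
          gcongr
          exact hsum _ (hl i (Finset.mem_range.1 hi)).1
      _ = _ := by
          rw [← Finset.sum_mul, ← ENNReal.ofReal_mul (by positivity), mul_comm]
  calc _ ≤ ∑' k : ℤ, liminf (fun n ↦ lorentzNorm p (F n k)) atTop :=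
        ENNReal.tsum_le_tsum fun k ↦ lorentzNorm_le_liminf (by linarith) (fun n ↦ hFm n k) (hFlim k)
    _ ≤ liminf (fun n ↦ ∑' k : ℤ, lorentzNorm p (F n k)) atTop := by
        -- The sum over k is an integral against counting measure, so Fatou's lemma applies to it
        -- too.
        simp_rw [← lintegral_count]
        exact lintegral_liminf_le fun n ↦ measurable_from_top
    _ ≤ liminf (fun n ↦ ENNReal.ofReal (K * C₁ * C₂) *
          ∑ i ∈ Finset.range n, ENNReal.ofReal |c n i|) atTop :=
        liminf_le_liminf (.of_forall hFn)
    _ ≤ limsup (fun n ↦ ENNReal.ofReal (K * C₁ * C₂) *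
          ∑ i ∈ Finset.range n, ENNReal.ofReal |c n i|) atTop := liminf_le_limsup
    _ = _ := ENNReal.limsup_const_mul_of_ne_top ENNReal.ofReal_ne_top

end DSSpace

end

/-! ### The main theorem -/

theorem mainTheorem2 (d : ℕ) (α β : ℝ) (hα : 0 < α) (hαd : α < d) (hβ : 0 < β) (hβd : β ≤ d)
    (Ξ : 𝓢(EuclideanSpace ℝ (Fin d), ℂ)) (hΞ : DSSpace.IsLPGenerator Ξ) :
    ∃ C : ℝ, 0 < C ∧ ∀ μ : SignedMeasure (EuclideanSpace ℝ (Fin d)), DSSpace.MemDS β μ →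
      (∀ᵐ x, IntegrableOn (DSSpace.rieszIntegrand α μ x) (Ioi 0)) ∧
      ∃ T : 𝓢'(EuclideanSpace ℝ (Fin d), ℂ),
        DSSpace.IsGivenBy T (DSSpace.rieszPotential α μ) ∧
        DSSpace.besovLorentzNorm Ξ ((d : ℝ) / ((d : ℝ) - α)) T ≤
          ENNReal.ofReal C * DSSpace.dsNorm β μ := by
  obtain ⟨Ψ, Φ, hΨ, hΦ⟩ := DSSpace.exists_riesz_profile hα hΞ
  obtain ⟨C, hC, hbound⟩ := DSSpace.tsum_lorentzNorm_pairing_le hα hαd hβ hΦ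
  refine ⟨C, hC, fun μ _ ↦ ⟨DSSpace.ae_integrableOn_rieszIntegrand hα hαd μ, ?_⟩⟩
  obtain ⟨T, hT, hTg⟩ := DSSpace.exists_isGivenBy_rieszPotential hα hαd μ
  refine ⟨T, hT, ?_⟩
  have hC0 : ENNReal.ofReal C ≠ 0 := (ENNReal.ofReal_pos.2 hC).ne'
  -- Dividing by C isolates the infimum defining the norm, so each atomic representation can be
  -- treated separately.
  rw [mul_comm, ← ENNReal.div_le_iff hC0 ENNReal.ofReal_ne_top]
  refine le_iInf fun c ↦ le_iInf fun a ↦ le_iInf fun h ↦ ?_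
  rw [ENNReal.div_le_iff hC0 ENNReal.ofReal_ne_top, mul_comm]
  refine le_trans (le_of_eq ?_) (hbound μ c a h)
  rw [DSSpace.besovLorentzNorm]
  congr 1 with k
  congr 1
  ext x
  exact DSSpace.lpProj_eq_pairing hα hΨ hTg k x
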